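/- Let $n\in\mathbb N$. On $\mathbb{R}^{n}\times\mathbb{R}$, with points $(x,u)$, consider the Grušin vector fields $X_j=\partial_{x_j}$, $U_j=x_j\partial_u$, $j=1,\dots,n$. For a tangent vector $v$ at $p$ let $\|v\|_p^2$ be the infimum of $\sum_j(\alpha_j^2+\beta_j^2)$ over all representations $v=\sum_j(\alpha_jX_j(p)+\beta_jU_j(p))$ (with $\inf\varnothing=\infty$). A horizontal curve is an absolutely continuous curve $\gamma$ on $[0,1]$ with $\dot\gamma(t)$ in the span of the $X_j(\gamma(t)),U_j(\gamma(t))$ for almost every $t$; its length is $L(\gamma)=\int_0^1\|\dot\gamma(t)\|_{\gamma(t)}\,dt$, and the Carnot–Carathéodory distance $d_{CC}(p,q)$ is the infimum of the lengths of the horizontal curves from $p$ to $q$. A geodesic is a curve $\gamma=(\gamma_{(1)},\gamma_{(2)})$ on $[0,1]$ that solves the Euler–Lagrange equations $\ddot\gamma_{(1)}+\eta^2\gamma_{(1)}=0$, $\dot\eta=0$, where $\dot\gamma_{(2)}=\eta\,|\gamma_{(1)}|^2$. For $b\neq0$, $c\in\mathbb{R}^n$ let $\gamma^{b,c}$ be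 the curve $$\gamma^{b,c}_{(1)}(t)=\tfrac{c}{b}\sin(bt)+x\cos(bt),$$ $$\gamma^{b,c}_{(2)}(t)=\tfrac{|c|^2}{b}\Big(\tfrac t2-\tfrac{\sin(2bt)}{4b}\Big)+\tfrac{x\cdot c}{b}\sin^2(bt)+|x|^2b\Big(\tfrac t2+\tfrac{\sin(2bt)}{4b}\Big),$$ which starts at $(x,0)$. Let $\tilde\mu(b)=\frac{b}{\sin^2b}-\cot b$ for $b\in\mathbb{R}\setminus\pi\mathbb{Z}$ and $\tilde\mu(0)=0$. **Theorem.** Let $x\in\mathbb{R}^n$, $x\neq0$, $u>0$. The geodesics connecting $(x,0)$ and $(-x,u)$ are exactly the following. 1. For any solution $b$ (with $b/2\notin\pi\mathbb{Z}\setminus\{0\}$) of $$\frac{u}{|x|^2}=\tilde\mu\Big(\frac b2\Big)\qquad(*)$$ the curve $\gamma^b:=\gamma^{b,c}$ with $c=-b\cot(\tfrac b2)\,x$ is such a geodesic, with $$L(\gamma^b)^2=\frac{b^2}{\sin^2\frac b2}|x|^2=2bu+2|x|^2b\cot\frac b2,$$ and $L(\gamma^b)$ is strictly increasing in the solution $b$.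 2. For each integer $m\ge0$ with $2u\ge(2m+1)\pi|x|^2$ there are vectors $c\in\mathbb{R}^n$ with $|c|=\sqrt{2(2m+1)\pi u-(2m+1)^2\pi^2|x|^2}$, and for every such $c$ the curve $\gamma^{b,c}$ with $b=(2m+1)\pi$ is such a geodesic, with length $L(\gamma^{b,c})=\sqrt{2(2m+1)\pi u}$. The set of solutions $b$ of $(*)$ and the set of admissible $m$ are finite; if $n=1$ or $2u\le\pi|x|^2$, then there are only finitely many geodesics connecting $(x,0)$ and $(-x,u)$. If $2u<\pi|x|^2$, then $(*)$ has a unique solution $b$ in $(0,\pi)$, the curve $\gamma^b$ is strictly shorter than every other geodesic connecting the two points, and $$d_{CC}\big((x,0),(-x,u)\big)=L(\gamma^b)=\frac{b}{\sin\frac b2}|x|=\sqrt{2bu+2|x|^2b\cot\tfrac b2}.$$ If $2u\ge\pi|x|^2$, then $$d_{CC}\big((x,0),(-x,u)\big)=\sqrt{2\pi u}.$$ -/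

import Mathlib

open MeasureTheory Set
open scoped ENNReal

noncomputable section

section CarnotCaratheodory

variable {ι E : Type*} [Fintype ι] [NormedAddCommGroup E] [NormedSpace ℝ E]

/-- The squared length `inf {∑ α_j ^ 2 : v = ∑ α_j X_j(p)}` of a tangent vector `v` at `p` with
respect to the vector fields `X_j`; the infimum over the empty set is `∞`. -/
def horizontalNormSq (X : ι → E → E) (p v : E) : ℝ≥0∞ :=
  ⨅ (α : ι → ℝ) (_ : v = ∑ j, α j • X j p), ENNReal.ofReal (∑ j, α j ^ 2)

/-- A horizontal curve on `[0,1]`: an absolutely continuous curve whose velocity lies almost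
everywhere in the span of the vector fields. Values outside `[0,1]` are irrelevant. -/
def IsHorizontalCurve (X : ι → E → E) (γ : ℝ → E) : Prop :=
  AbsolutelyContinuousOnInterval γ 0 1 ∧
    ∀ᵐ t ∂(volume.restrict (Icc (0 : ℝ) 1)),
      deriv γ t ∈ Submodule.span ℝ (Set.range fun j => X j (γ t))

/-- The length `∫₀¹ ‖γ'(t)‖_{γ(t)} dt` of a curve on `[0,1]`. -/
def horizontalLength (X : ι → E → E) (γ : ℝ → E) : ℝ≥0∞ :=
  ∫⁻ t in Icc (0 : ℝ) 1, horizontalNormSq X (γ t) (deriv γ t) ^ (1 / 2 : ℝ)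

/-- The Carnot-Carathéodory distance: the infimum of the lengths of the horizontal curves
from `p` to `q`. -/
def ccDist (X : ι → E → E) (p q : E) : ℝ≥0∞ :=
  ⨅ (γ : ℝ → E) (_ : IsHorizontalCurve X γ ∧ γ 0 = p ∧ γ 1 = q), horizontalLength X γ

end CarnotCaratheodory

/-- The space `ℝⁿ × ℝ`, with points `(x, u)`. -/
abbrev GrusinSpace (n : ℕ) : Type := EuclideanSpace ℝ (Fin n) × ℝ

/-- The Grušin vector fields `X_j = ∂_{x_j}` (left summand) and `U_j = x_j ∂_u` (right summand). -/
def grusinField (n : ℕ) : Fin n ⊕ Fin n → GrusinSpace n → GrusinSpace n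
  | Sum.inl j, _ => (EuclideanSpace.single j 1, 0)
  | Sum.inr j, p => (0, p.1 j)

/-- The length of a curve with respect to the Grušin vector fields. -/
def grusinLength {n : ℕ} (γ : ℝ → GrusinSpace n) : ℝ≥0∞ :=
  horizontalLength (grusinField n) γ

/-- The Carnot-Carathéodory distance associated to the Grušin vector fields. -/
def grusinDist {n : ℕ} (p q : GrusinSpace n) : ℝ≥0∞ :=
  ccDist (grusinField n) p q

/-- Geodesics `γ = (γ₁, γ₂)` on `[0,1]`: solutions of the Euler-Lagrange equations
`γ₁'' + (γ₂' ^ 2 / |γ₁| ^ 4) γ₁ = 0` and `(γ₂' / |γ₁| ^ 2)' = 0` of the energy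
`∫ (γ₂' ^ 2 / |γ₁| ^ 2 + |γ₁'| ^ 2)`. Here `v = γ₁'`, and `η` is the quotient `γ₂' / |γ₁| ^ 2`,
extended across the zeros of `γ₁` (where the velocity of a horizontal curve has `γ₂' = 0`). -/
def IsGrusinGeodesic {n : ℕ} (γ : ℝ → GrusinSpace n) : Prop :=
  ∃ (v : ℝ → EuclideanSpace ℝ (Fin n)) (η : ℝ → ℝ), ∀ t ∈ Icc (0 : ℝ) 1,
    HasDerivWithinAt (fun s => (γ s).1) (v t) (Icc 0 1) t ∧
    HasDerivWithinAt (fun s => (γ s).2) (η t * ‖(γ t).1‖ ^ 2) (Icc 0 1) t ∧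
    HasDerivWithinAt v (-(η t ^ 2 • (γ t).1)) (Icc 0 1) t ∧
    HasDerivWithinAt η 0 (Icc 0 1) t

/-- `γ` is a geodesic from `p` to `q`. -/
def IsGrusinGeodesicFromTo {n : ℕ} (p q : GrusinSpace n) (γ : ℝ → GrusinSpace n) : Prop :=
  IsGrusinGeodesic γ ∧ γ 0 = p ∧ γ 1 = q

/-- The explicit curve `γ^{b,c}` starting at `p = (x₁, u₁)`. -/
def grusinCurve {n : ℕ} (p : GrusinSpace n) (b : ℝ) (c : EuclideanSpace ℝ (Fin n)) (t : ℝ) :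
    GrusinSpace n :=
  if b = 0 then (t • c + p.1, p.2)
  else
    ((Real.sin (b * t) / b) • c + Real.cos (b * t) • p.1,
      ‖c‖ ^ 2 / b * (t / 2 - Real.sin (2 * b * t) / (4 * b))
        + inner ℝ p.1 c / b * Real.sin (b * t) ^ 2
        + ‖p.1‖ ^ 2 * b * (t / 2 + Real.sin (2 * b * t) / (4 * b)) + p.2)

/-- The function `b / sin² b - cot b`, considered for `b` not a nonzero multiple of `π`
(its value at `0` is `0`, the continuous extension). -/
def muTilde (b : ℝ) : ℝ := b / Real.sin b ^ 2 - Real.cot b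

/-- `b` solves `u / |x|² = muTilde (b / 2)`, with `b / 2` in the domain of `muTilde`. -/
def IsMuTildeSolution {n : ℕ} (x : EuclideanSpace ℝ (Fin n)) (u b : ℝ) : Prop :=
  (∀ k : ℤ, k ≠ 0 → b / 2 ≠ k * Real.pi) ∧ u / ‖x‖ ^ 2 = muTilde (b / 2)

/-- The curve `γ^b` from `(x, 0)`, i.e. `γ^{b,c}` with `c = -b cot(b/2) x`. For `b ∉ πℤ` this is
`c = (b / sin b) (y - cos b x)`, the only `c` for which the first component ends at `y = -x`. -/
def antipodalCurve {n : ℕ} (x : EuclideanSpace ℝ (Fin n)) (b : ℝ) : ℝ → GrusinSpace n :=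
  grusinCurve (x, 0) b (-(b * Real.cot (b / 2)) • x)

end

/-!
The Euler-Lagrange equations make `η` a constant `b`, and then `γ₁'' = -b² γ₁` is the harmonic
oscillator. Two constants of motion integrate it, so every geodesic is one of the explicit curves
`γ^{b,c}` (`IsGrusinGeodesic.exists_eqOn_grusinCurve`), whose speed is the constant `(|c|² + b²
|x|²)^{1/2}`. The condition `γ₁(1) = -x` fixes `c`, unless `b` is an odd multiple of `π`; the
condition `γ₂(1) = u` is then the equation `u / |x|² = muTilde (b / 2)` in the first case and a
condition on `|c|` in the second (`IsGrusinGeodesicFromTo.antipodal_cases`).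

Put `s = b / 2` and `K = u / |x|²`. The squared length of `γ^b` is `4 |x|² s² / sin² s`, which at
a solution of `muTilde s = K` equals `4 |x|² (s K + s cot s)`. The derivatives `muTilde' = 2 (1 -
s cot s) / sin² s` and `(s K + s cot s)' = K - muTilde s` show that on each branch `(kπ, (k+1)π)`
there is a turning point `t`, with `t cot t = 1` (and `t = 0` for `k = 0`), on either side of
which `muTilde` is strictly monotone, and that `s² / sin² s` lies between `s K + 1` and `t K + 1`
at a solution (`exists_branch_bounds`). This orders the lengths within a branch, and different
branches are separated by the values `kπ K + 1`. The same monotonicity, together with the bound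
`s² ≤ s K + 1 / 4`, gives finiteness.

The lower bound for the distance needs neither existence of minimizers nor reparametrization. For
`0 < b < π` there is an explicit function `Φ` of time and position, `grusinCalibration`, with `∂_τ
Φ + dΦ(v) ≤ |v|²` for all horizontal `v` and `Φ(1, (-x, u)) - Φ(0, (x, 0)) = 2 b u + 2 |x|² b cot
(b / 2)`. Along an absolutely continuous horizontal curve, with its own (slightly regularized)
normalized arclength as time, the fundamental theorem of calculus bounds this difference by the
squared length (`grusinCalibration_sub_le`). If `2 u < π |x|²`, the solution `b` in `(0, π)`
attains the bound; if `2 u ≥ π |x|²`, the limit `b → π` of the bounds is `2 π u`, which the curves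
`γ^{π,c}` attain.
-/

/-! ### The function `muTilde` -/

theorem muTilde_eq {s : ℝ} (hs : Real.sin s ≠ 0) :
    muTilde s = (s - Real.sin s * Real.cos s) / Real.sin s ^ 2 := by
  rw [muTilde, Real.cot_eq_cos_div_sin]
  field_simp

theorem muTilde_neg (s : ℝ) : muTilde (-s) = -muTilde s := by
  simp only [muTilde, Real.cot_eq_cos_div_sin, Real.sin_neg, Real.cos_neg]
  ring

theorem sin_mul_cos_lt_self {s : ℝ} (hs : 0 < s) : Real.sin s * Real.cos s < s := by
  have h := Real.sin_lt (x := 2 * s) (by linarith)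
  rw [Real.sin_two_mul] at h
  linarith

theorem muTilde_nonneg {s : ℝ} (hs : 0 ≤ s) : 0 ≤ muTilde s := by
  by_cases h : Real.sin s = 0
  · simp [muTilde, h, Real.cot_eq_cos_div_sin]
  · rw [muTilde_eq h]
    rcases hs.eq_or_lt with rfl | hs
    · simp
    · exact div_nonneg (sub_nonneg.2 (sin_mul_cos_lt_self hs).le) (sq_nonneg _)

theorem pos_of_muTilde_pos {s : ℝ} (h : 0 < muTilde s) : 0 < s := by
  by_contra hs
  have := muTilde_nonneg (s := -s) (by linarith)
  rw [muTilde_neg] at this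
  linarith

theorem hasDerivAt_cot {s : ℝ} (hs : Real.sin s ≠ 0) :
    HasDerivAt Real.cot (-1 / Real.sin s ^ 2) s := by
  have h := (Real.hasDerivAt_cos s).div (Real.hasDerivAt_sin s) hs
  have e : Real.cot = Real.cos / Real.sin := by
    ext t
    simp [Real.cot_eq_cos_div_sin]
  rw [e]
  refine h.congr_deriv ?_
  congr 1
  linear_combination -Real.sin_sq_add_cos_sq s

theorem hasDerivAt_mul_cot {s : ℝ} (hs : Real.sin s ≠ 0) :
    HasDerivAt (fun s => s * Real.cot s) (-muTilde s) s := by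
  refine ((hasDerivAt_id s).mul (hasDerivAt_cot hs)).congr_deriv ?_
  simp only [muTilde, id]
  ring

theorem hasDerivAt_muTilde {s : ℝ} (hs : Real.sin s ≠ 0) :
    HasDerivAt muTilde (2 * (1 - s * Real.cot s) / Real.sin s ^ 2) s := by
  have h := ((hasDerivAt_id s).div ((Real.hasDerivAt_sin s).pow 2) (pow_ne_zero 2 hs)).sub
    (hasDerivAt_cot hs)
  refine HasDerivAt.congr_deriv (f := muTilde) h ?_
  simp only [Real.cot_eq_cos_div_sin, id]
  field_simp
  simp
  ring

/-- The left side is the squared length of the geodesic with parameter `b = 2 s`, divided by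
`4 ‖x‖²`. At a solution of `muTilde s = K` the right side is `s K + s cot s`, whose derivative for
fixed `K` is `K - muTilde s`. -/
theorem sq_div_sin_sq (s : ℝ) :
    s ^ 2 / Real.sin s ^ 2 = s * muTilde s + s * Real.cot s := by
  simp only [muTilde]
  ring

/-- Solutions of `muTilde s = K` are bounded, because the equation is quadratic in `s cot s` with
discriminant `1 + 4 s (K - s)`. -/
theorem sq_le_of_sin_ne_zero {s : ℝ} (hs : Real.sin s ≠ 0) :
    s ^ 2 ≤ s * muTilde s + 1 / 4 := by
  have h : s * muTilde s = s ^ 2 + (s * Real.cot s) ^ 2 - s * Real.cot s := by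
    simp only [muTilde, Real.cot_eq_cos_div_sin]
    field_simp
    linear_combination (s ^ 2) * (Real.sin_sq_add_cos_sq s).symm
  nlinarith [sq_nonneg (s * Real.cot s - 1 / 2)]

theorem sin_ne_zero_of_mem_branch {k : ℕ} {s : ℝ}
    (hs : s ∈ Ioo (k * Real.pi) ((k + 1) * Real.pi)) : Real.sin s ≠ 0 := by
  intro h
  obtain ⟨j, rfl⟩ := Real.sin_eq_zero_iff.1 h
  have h1 := lt_of_mul_lt_mul_right hs.1 Real.pi_pos.le
  have h2 := lt_of_mul_lt_mul_right hs.2 Real.pi_pos.le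
  have h3 : ((k : ℤ) : ℝ) < j := by exact_mod_cast h1
  have h4 : (j : ℝ) < ((k + 1 : ℤ) : ℝ) := by exact_mod_cast h2
  rw [Int.cast_lt] at h3 h4
  omega

theorem exists_branch {s : ℝ} (hs : 0 < s) (h : Real.sin s ≠ 0) :
    ∃ k : ℕ, s ∈ Ioo (k * Real.pi) ((k + 1) * Real.pi) := by
  refine ⟨⌊s / Real.pi⌋₊, lt_of_le_of_ne ?_ ?_, ?_⟩
  · exact (le_div_iff₀ Real.pi_pos).1 (Nat.floor_le (by positivity))
  · intro e
    exact h (e ▸ Real.sin_nat_mul_pi _)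
  · exact (div_lt_iff₀ Real.pi_pos).1 (Nat.lt_floor_add_one _)

theorem strictAntiOn_mul_cot (k : ℕ) :
    StrictAntiOn (fun s => s * Real.cot s) (Ioo (k * Real.pi) ((k + 1) * Real.pi)) := by
  refine strictAntiOn_of_deriv_neg (convex_Ioo _ _) (fun s hs =>
    (hasDerivAt_mul_cot (sin_ne_zero_of_mem_branch hs)).continuousAt.continuousWithinAt) ?_
  rw [interior_Ioo]
  intro s hs
  have h := sin_ne_zero_of_mem_branch hs
  have hs0 : 0 < s := lt_of_le_of_lt (by positivity) hs.1
  rw [(hasDerivAt_mul_cot h).deriv, muTilde_eq h, neg_lt_zero]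
  exact div_pos (sub_pos.2 (sin_mul_cos_lt_self hs0)) (by positivity)

theorem mul_cot_lt_one {s : ℝ} (hs : s ∈ Ioo 0 Real.pi) : s * Real.cot s < 1 := by
  have hsin := Real.sin_pos_of_mem_Ioo hs
  rw [Real.cot_eq_cos_div_sin, ← mul_div_assoc, div_lt_one hsin]
  rcases lt_or_ge s (Real.pi / 2) with h2 | h2
  · have hc := Real.cos_pos_of_mem_Ioo ⟨by linarith [hs.1, Real.pi_pos], h2⟩
    have := Real.lt_tan hs.1 h2
    rwa [Real.tan_eq_sin_div_cos, lt_div_iff₀ hc] at this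
  · have hc := Real.cos_nonpos_of_pi_div_two_le_of_le h2 (by linarith [hs.2, Real.pi_pos])
    nlinarith [hs.1]

theorem cot_nat_mul_pi_add_pi_div_four (k : ℕ) : Real.cot (k * Real.pi + Real.pi / 4) = 1 := by
  rw [add_comm, Real.cot_eq_cos_div_sin, Real.cos_add_nat_mul_pi, Real.sin_add_nat_mul_pi,
    Real.cos_pi_div_four, Real.sin_pi_div_four]
  exact div_self (by positivity)

/-- Each branch `(kπ, (k+1)π)` of the cotangent has a turning point `t` to the left of which
`s cot s > 1` and to the right of which `s cot s < 1`. For `k = 0` it degenerates to `t = 0`. -/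
theorem exists_turning_point (k : ℕ) :
    ∃ t ∈ Ico (k * Real.pi) ((k + 1) * Real.pi),
      (k * Real.pi < t → t * Real.cot t = 1) ∧
      (∀ s ∈ Ioo (k * Real.pi) ((k + 1) * Real.pi), s < t → 1 < s * Real.cot s) ∧
      ∀ s ∈ Ioo (k * Real.pi) ((k + 1) * Real.pi), t < s → s * Real.cot s < 1 := by
  have hpi := Real.pi_pos
  rcases Nat.eq_zero_or_pos k with rfl | hk
  · refine ⟨0, by simp [hpi], by simp, fun s hs h => ?_, fun s hs h => ?_⟩
    · simp at hs; linarith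
    · simp only [Nat.cast_zero, zero_mul, zero_add, one_mul] at hs
      exact mul_cot_lt_one hs
  · have hk1 : (1 : ℝ) ≤ k := by exact_mod_cast hk
    have hsub : Icc (k * Real.pi + Real.pi / 4) (k * Real.pi + Real.pi / 2) ⊆
        Ioo (k * Real.pi) ((k + 1) * Real.pi) := fun s hs =>
      ⟨by linarith [hs.1], by linarith [hs.2]⟩
    have hcont : ContinuousOn (fun s => s * Real.cot s)
        (Icc (k * Real.pi + Real.pi / 4) (k * Real.pi + Real.pi / 2)) := fun s hs =>
      (hasDerivAt_mul_cot (sin_ne_zero_of_mem_branch (hsub hs))).continuousAt.continuousWithinAt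
    obtain ⟨t, ht, ht1⟩ := intermediate_value_Icc' (by linarith) hcont
      (show (1 : ℝ) ∈ Icc _ _ from ⟨by
        rw [add_comm, Real.cot_eq_cos_div_sin, Real.cos_add_nat_mul_pi]
        simp, by
        rw [cot_nat_mul_pi_add_pi_div_four]
        nlinarith [Real.pi_gt_three]⟩)
    have htk := hsub ht
    have hanti := strictAntiOn_mul_cot k
    exact ⟨t, ⟨htk.1.le, htk.2⟩, fun _ => ht1, fun s hs h => ht1 ▸ hanti hs htk h,
      fun s hs h => ht1 ▸ hanti htk hs h⟩

theorem strictAntiOn_muTilde {a t : ℝ} (h : ∀ s ∈ Ioc a t, Real.sin s ≠ 0)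
    (h1 : ∀ s ∈ Ioo a t, 1 < s * Real.cot s) : StrictAntiOn muTilde (Ioc a t) := by
  refine strictAntiOn_of_deriv_neg (convex_Ioc _ _)
    (fun s hs => (hasDerivAt_muTilde (h s hs)).continuousAt.continuousWithinAt) ?_
  rw [interior_Ioc]
  intro s hs
  have hsin := h s ⟨hs.1, hs.2.le⟩
  rw [(hasDerivAt_muTilde hsin).deriv]
  exact div_neg_of_neg_of_pos (by linarith [h1 s hs]) (by positivity)

theorem strictMonoOn_muTilde {D : Set ℝ} (hD : Convex ℝ D) (h : ∀ s ∈ D, Real.sin s ≠ 0)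
    (h1 : ∀ s ∈ interior D, s * Real.cot s < 1) : StrictMonoOn muTilde D := by
  refine strictMonoOn_of_deriv_pos hD
    (fun s hs => (hasDerivAt_muTilde (h s hs)).continuousAt.continuousWithinAt) ?_
  intro s hs
  have hsin := h s (interior_subset hs)
  rw [(hasDerivAt_muTilde hsin).deriv]
  exact div_pos (by linarith [h1 s hs]) (by positivity)

/-- `s ↦ s K + s cot s`, whose derivative is `K - muTilde s`, is strictly increasing between two
points where `muTilde < K` in between. -/
theorem mul_add_mul_cot_lt {K s t : ℝ} (hst : s < t) (h : ∀ r ∈ Icc s t, Real.sin r ≠ 0)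
    (h1 : ∀ r ∈ Ioo s t, muTilde r < K) :
    s * K + s * Real.cot s < t * K + t * Real.cot t := by
  have hd : ∀ r ∈ Icc s t, HasDerivAt (fun r => r * K + r * Real.cot r) (K - muTilde r) r :=
    fun r hr => (((hasDerivAt_id r).mul_const K).add
      (hasDerivAt_mul_cot (h r hr))).congr_deriv (by ring)
  refine strictMonoOn_of_deriv_pos (convex_Icc s t)
    (fun r hr => (hd r hr).continuousAt.continuousWithinAt) ?_
    (left_mem_Icc.2 hst.le) (right_mem_Icc.2 hst.le) hst
  rw [interior_Icc]
  intro r hr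
  rw [(hd r ⟨hr.1.le, hr.2.le⟩).deriv]
  linarith [h1 r hr]

/-- On the branch `(kπ, (k+1)π)` the equation `muTilde s = K` has at most one solution on either
side of the turning point `t`, and `s² / sin² s` at a solution lies between `s K + 1` and
`t K + 1`. -/
theorem exists_branch_bounds (k : ℕ) :
    ∃ t ∈ Ico (k * Real.pi) ((k + 1) * Real.pi),
      InjOn muTilde (Ioc (k * Real.pi) t) ∧
      InjOn muTilde (Ioo (k * Real.pi) ((k + 1) * Real.pi) ∩ Ici t) ∧
      ∀ s ∈ Ioo (k * Real.pi) ((k + 1) * Real.pi),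
        (s ≤ t → s * muTilde s + 1 ≤ s ^ 2 / Real.sin s ^ 2) ∧
        (s < t → s ^ 2 / Real.sin s ^ 2 < t * muTilde s + 1) ∧
        (t ≤ s → s ^ 2 / Real.sin s ^ 2 ≤ s * muTilde s + 1) ∧
        (t < s → t * muTilde s + 1 < s ^ 2 / Real.sin s ^ 2) := by
  obtain ⟨t, ht, ht1, hl, hr⟩ := exists_turning_point k
  have hanti : StrictAntiOn muTilde (Ioc (k * Real.pi) t) :=
    strictAntiOn_muTilde (fun s hs => sin_ne_zero_of_mem_branch ⟨hs.1, hs.2.trans_lt ht.2⟩)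
      (fun s hs => hl s ⟨hs.1, hs.2.trans ht.2⟩ hs.2)
  have hmono : StrictMonoOn muTilde (Ioo (k * Real.pi) ((k + 1) * Real.pi) ∩ Ici t) := by
    refine strictMonoOn_muTilde ((convex_Ioo _ _).inter (convex_Ici _))
      (fun s hs => sin_ne_zero_of_mem_branch hs.1) fun s hs => ?_
    rw [interior_inter, interior_Ici, interior_Ioo] at hs
    exact hr s hs.1 hs.2
  refine ⟨t, ht, hanti.injOn, hmono.injOn, fun s hs => ?_⟩
  have hsin := sin_ne_zero_of_mem_branch hs
  rw [sq_div_sin_sq]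
  refine ⟨fun h => ?_, fun h => ?_, fun h => ?_, fun h => ?_⟩
  · rcases h.eq_or_lt with rfl | h
    · rw [ht1 hs.1]
    · linarith [hl s hs h]
  · have := mul_add_mul_cot_lt (K := muTilde s) h
      (fun r hr' => sin_ne_zero_of_mem_branch ⟨hs.1.trans_le hr'.1, hr'.2.trans_lt ht.2⟩)
      (fun r hr' => hanti ⟨hs.1, h.le⟩ ⟨hs.1.trans hr'.1, hr'.2.le⟩ hr'.1)
    rwa [ht1 (hs.1.trans h)] at this
  · rcases h.eq_or_lt with rfl | h
    · rw [ht1 hs.1]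
    · linarith [hr s hs h]
  · rcases ht.1.eq_or_lt with h0 | h0
    · -- A turning point at the left end of the branch occurs only for `k = 0`, `t = 0`.
      have hk : k = 0 := by
        by_contra hk
        have hk1 : (1 : ℝ) ≤ k := by exact_mod_cast Nat.one_le_iff_ne_zero.2 hk
        have hpi := Real.pi_gt_three
        have hm : k * Real.pi + Real.pi / 4 ∈ Ioo (k * Real.pi) ((k + 1) * Real.pi) :=
          ⟨by linarith, by linarith⟩
        have h1 := hr _ hm (by linarith)
        rw [cot_nat_mul_pi_add_pi_div_four] at h1
        nlinarith
      have ht0 : t = 0 := by rw [← h0, hk]; simp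
      subst ht0
      rw [← sq_div_sin_sq, zero_mul, zero_add, one_lt_div (by positivity)]
      exact Real.sin_sq_lt_sq h.ne'
    · have := mul_add_mul_cot_lt (K := muTilde s) h
        (fun r hr' => sin_ne_zero_of_mem_branch ⟨h0.trans_le hr'.1, hr'.2.trans_lt hs.2⟩)
        (fun r hr' => hmono ⟨⟨h0.trans hr'.1, hr'.2.trans hs.2⟩, hr'.1.le⟩ ⟨hs, h.le⟩ hr'.2)
      rwa [ht1 h0] at this

/-- Along the solutions of `muTilde s = K`, the quantity `s² / sin² s` increases. Within a branch
the two solutions are separated by the turning point; different branches are separated by the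
bounds of `exists_branch_bounds`. -/
theorem sq_div_sin_sq_lt {K s s' : ℝ} (hK : 0 < K) (hs : Real.sin s ≠ 0) (hs' : Real.sin s' ≠ 0)
    (h : muTilde s = K) (h' : muTilde s' = K) (hlt : s < s') :
    s ^ 2 / Real.sin s ^ 2 < s' ^ 2 / Real.sin s' ^ 2 := by
  have hs0 := pos_of_muTilde_pos (h ▸ hK)
  obtain ⟨k, hk⟩ := exists_branch hs0 hs
  obtain ⟨k', hk'⟩ := exists_branch (hs0.trans hlt) hs'
  obtain ⟨t, ht, hinjl, hinjr, hb⟩ := exists_branch_bounds k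
  obtain ⟨b1, b2, b3, b4⟩ := hb s hk
  have hkk : k ≤ k' := by
    have h1 : (k : ℝ) * Real.pi < (k' + 1) * Real.pi := hk.1.trans (hlt.trans hk'.2)
    have h2 : (k : ℝ) < ((k' + 1 : ℕ) : ℝ) := by
      push_cast
      exact lt_of_mul_lt_mul_right h1 Real.pi_pos.le
    have := Nat.cast_lt.1 h2
    omega
  rcases hkk.eq_or_lt with rfl | hkk
  · obtain ⟨b1', b2', b3', b4'⟩ := hb s' hk'
    rw [h] at b1 b2 b3 b4
    rw [h'] at b1' b2' b3' b4'
    rcases le_or_gt s' t with h1 | h1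
    · exact absurd (hinjl ⟨hk.1, hlt.le.trans h1⟩ ⟨hk'.1, h1⟩ (h.trans h'.symm)) hlt.ne
    · rcases lt_or_ge s t with h2 | h2
      · exact (b2 h2).trans (b4' h1)
      · exact absurd (hinjr ⟨hk, h2⟩ ⟨hk', h1.le⟩ (h.trans h'.symm)) hlt.ne
  · obtain ⟨t', ht', -, -, hb'⟩ := exists_branch_bounds k'
    obtain ⟨b1', b2', b3', b4'⟩ := hb' s' hk'
    rw [h] at b1 b2 b3 b4
    rw [h'] at b1' b2' b3' b4'
    have hkk' : ((k : ℝ) + 1) * Real.pi ≤ k' * Real.pi := by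
      have : ((k : ℝ) + 1) ≤ k' := by exact_mod_cast hkk
      exact mul_le_mul_of_nonneg_right this Real.pi_pos.le
    -- The number `(k + 1) π K + 1` separates the values on the two branches.
    have hup : s ^ 2 / Real.sin s ^ 2 < (k + 1) * Real.pi * K + 1 := by
      rcases lt_or_ge s t with h2 | h2
      · have := mul_lt_mul_of_pos_right ht.2 hK
        linarith [b2 h2]
      · have := mul_lt_mul_of_pos_right hk.2 hK
        linarith [b3 h2]
    have hlow : k' * Real.pi * K + 1 ≤ s' ^ 2 / Real.sin s' ^ 2 := by
      rcases le_or_gt s' t' with h2 | h2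
      · have := mul_le_mul_of_nonneg_right hk'.1.le hK.le
        linarith [b1' h2]
      · have := mul_le_mul_of_nonneg_right ht'.1 hK.le
        linarith [b4' h2]
    have := mul_le_mul_of_nonneg_right hkk' hK.le
    linarith

theorem finite_muTilde_eq {K : ℝ} (hK : 0 < K) :
    {s : ℝ | Real.sin s ≠ 0 ∧ muTilde s = K}.Finite := by
  obtain ⟨N, hN⟩ := exists_nat_gt (K + 1)
  choose t ht hl hr _ using exists_branch_bounds
  refine ((Finset.range N).finite_toSet.biUnion (t := fun k =>
    (Ioc (k * Real.pi) (t k) ∩ muTilde ⁻¹' {K}) ∪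
    ((Ioo (k * Real.pi) ((k + 1) * Real.pi) ∩ Ici (t k)) ∩ muTilde ⁻¹' {K}))
    fun k _ => ?_).subset ?_
  · refine Set.Finite.union (Set.Subsingleton.finite ?_) (Set.Subsingleton.finite ?_)
    · exact fun a ha b hb => hl k ha.1 hb.1 (ha.2.trans hb.2.symm)
    · exact fun a ha b hb => hr k ha.1 hb.1 (ha.2.trans hb.2.symm)
  · rintro s ⟨hs, h⟩
    have hs0 := pos_of_muTilde_pos (h ▸ hK)
    obtain ⟨k, hk⟩ := exists_branch hs0 hs
    have hsq := sq_le_of_sin_ne_zero hs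
    rw [h] at hsq
    have hsK : s ≤ K + 1 := by nlinarith
    have hkN : k < N := by
      have h1 : (k : ℝ) * 1 ≤ k * Real.pi :=
        mul_le_mul_of_nonneg_left (by linarith [Real.pi_gt_three]) (Nat.cast_nonneg k)
      have h2 : (k : ℝ) < N := by linarith [hk.1]
      exact_mod_cast h2
    simp only [Finset.coe_range, mem_Iio, mem_iUnion]
    refine ⟨k, hkN, ?_⟩
    rcases le_or_gt s (t k) with h2 | h2
    · exact Or.inl ⟨⟨hk.1, h2⟩, h⟩
    · exact Or.inr ⟨⟨hk, h2.le⟩, h⟩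

theorem injOn_muTilde_Ioo : InjOn muTilde (Ioo 0 Real.pi) :=
  (strictMonoOn_muTilde (convex_Ioo _ _) (fun _ hs => (Real.sin_pos_of_mem_Ioo hs).ne')
    fun _ hs => mul_cot_lt_one (interior_subset hs)).injOn

theorem exists_muTilde_eq {K : ℝ} (hK : 0 < K) (hK' : K < Real.pi / 2) :
    ∃ s ∈ Ioo 0 (Real.pi / 2), muTilde s = K := by
  have hpi := Real.pi_gt_three
  have hcont : ContinuousOn muTilde (Icc K (Real.pi / 2)) := fun s hs =>
    (hasDerivAt_muTilde (Real.sin_pos_of_mem_Ioo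
      ⟨by linarith [hs.1], by linarith [hs.2]⟩).ne').continuousAt.continuousWithinAt
  have hsin : 0 < Real.sin K := Real.sin_pos_of_mem_Ioo ⟨hK, by linarith⟩
  have hlow : muTilde K ≤ K := by
    have hc := Real.cos_pos_of_mem_Ioo (x := K) ⟨by linarith, hK'⟩
    have ht := Real.lt_tan hK hK'
    rw [Real.tan_eq_sin_div_cos, lt_div_iff₀ hc] at ht
    rw [muTilde_eq hsin.ne', div_le_iff₀ (by positivity)]
    nlinarith [Real.sin_sq_add_cos_sq K, mul_lt_mul_of_pos_right ht hc]
  have hup : K < muTilde (Real.pi / 2) := by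
    simpa [muTilde, Real.cot_eq_cos_div_sin] using hK'
  obtain ⟨s, hs, h⟩ := intermediate_value_Icc hK'.le hcont ⟨hlow, hup.le⟩
  refine ⟨s, ⟨by linarith [hs.1], lt_of_le_of_ne hs.2 ?_⟩, h⟩
  rintro rfl
  exact hup.ne' h

/-! ### Horizontal vectors and curves in the Grušin space -/

theorem sum_smul_grusinField {n : ℕ} (α : Fin n ⊕ Fin n → ℝ) (p : GrusinSpace n) :
    ∑ j, α j • grusinField n j p =
      (WithLp.toLp 2 fun j => α (Sum.inl j), ∑ j, α (Sum.inr j) * p.1 j) := by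
  rw [Fintype.sum_sum_type]
  refine Prod.ext ?_ ?_
  · simp only [grusinField, Prod.fst_add, Prod.fst_sum, Prod.smul_fst, smul_zero,
      Finset.sum_const_zero, add_zero]
    ext i
    simp [Finset.sum_apply, Pi.single_apply]
  · simp [grusinField, Prod.snd_sum]

/-- The junk value `v₂² / 0 = 0` makes the bound true also at the singular points `p.1 = 0`. -/
theorem ofReal_le_horizontalNormSq {n : ℕ} (p v : GrusinSpace n) :
    ENNReal.ofReal (‖v.1‖ ^ 2 + v.2 ^ 2 / ‖p.1‖ ^ 2) ≤
      horizontalNormSq (grusinField n) p v := by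
  refine le_iInf₂ fun α hα => ENNReal.ofReal_le_ofReal ?_
  rw [sum_smul_grusinField] at hα
  rw [hα, Fintype.sum_sum_type, EuclideanSpace.real_norm_sq_eq, EuclideanSpace.real_norm_sq_eq]
  refine add_le_add le_rfl ?_
  refine div_le_of_le_mul₀ (Finset.sum_nonneg fun _ _ => sq_nonneg _)
    (Finset.sum_nonneg fun _ _ => sq_nonneg _) ?_
  exact Finset.sum_mul_sq_le_sq_mul_sq Finset.univ (fun j => α (Sum.inr j)) fun j => p.1 j

theorem eq_sum_smul_grusinField {n : ℕ} {p v : GrusinSpace n} {η : ℝ} (h : v.2 = η * ‖p.1‖ ^ 2) :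
    v = ∑ j, Sum.elim (fun j => v.1 j) (fun j => η * p.1 j) j • grusinField n j p := by
  rw [sum_smul_grusinField]
  refine Prod.ext rfl ?_
  rw [h, EuclideanSpace.real_norm_sq_eq, Finset.mul_sum]
  exact Finset.sum_congr rfl fun j _ => by simp only [Sum.elim_inr]; ring

theorem horizontalNormSq_eq {n : ℕ} {p v : GrusinSpace n} {η : ℝ} (h : v.2 = η * ‖p.1‖ ^ 2) :
    horizontalNormSq (grusinField n) p v = ENNReal.ofReal (‖v.1‖ ^ 2 + η ^ 2 * ‖p.1‖ ^ 2) := by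
  refine le_antisymm ?_ ?_
  · refine iInf₂_le_of_le _ (eq_sum_smul_grusinField h)
      (ENNReal.ofReal_le_ofReal (le_of_eq ?_))
    rw [Fintype.sum_sum_type, EuclideanSpace.real_norm_sq_eq, EuclideanSpace.real_norm_sq_eq,
      Finset.mul_sum]
    simp only [Sum.elim_inl, Sum.elim_inr, mul_pow]
  · refine (ENNReal.ofReal_le_ofReal (le_of_eq ?_)).trans (ofReal_le_horizontalNormSq p v)
    rw [h]
    rcases eq_or_ne ‖p.1‖ 0 with h0 | h0
    · simp [h0]
    · field_simp

theorem mem_span_grusinField {n : ℕ} {p v : GrusinSpace n} {η : ℝ} (h : v.2 = η * ‖p.1‖ ^ 2) :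
    v ∈ Submodule.span ℝ (Set.range fun j => grusinField n j p) := by
  rw [eq_sum_smul_grusinField h]
  exact Submodule.sum_mem _ fun j _ => Submodule.smul_mem _ _ (Submodule.subset_span ⟨j, rfl⟩)

theorem snd_eq_zero_of_mem_span {n : ℕ} {p v : GrusinSpace n} (hp : p.1 = 0)
    (h : v ∈ Submodule.span ℝ (Set.range fun j => grusinField n j p)) : v.2 = 0 := by
  obtain ⟨α, rfl⟩ := (Submodule.mem_span_range_iff_exists_fun ℝ).1 h
  rw [sum_smul_grusinField]
  simp [hp]

theorem HasDerivAt.prodFst {E F : Type*} [NormedAddCommGroup E] [NormedSpace ℝ E]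
    [NormedAddCommGroup F] [NormedSpace ℝ F] {γ : ℝ → E × F} {v : E × F} {t : ℝ}
    (h : HasDerivAt γ v t) : HasDerivAt (fun s => (γ s).1) v.1 t :=
  (ContinuousLinearMap.fst ℝ E F).hasFDerivAt.comp_hasDerivAt t h

theorem HasDerivAt.prodSnd {E F : Type*} [NormedAddCommGroup E] [NormedSpace ℝ E]
    [NormedAddCommGroup F] [NormedSpace ℝ F] {γ : ℝ → E × F} {v : E × F} {t : ℝ}
    (h : HasDerivAt γ v t) : HasDerivAt (fun s => (γ s).2) v.2 t :=
  (ContinuousLinearMap.snd ℝ E F).hasFDerivAt.comp_hasDerivAt t h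

theorem grusinLength_congr {n : ℕ} {γ δ : ℝ → GrusinSpace n} (h : EqOn γ δ (Icc 0 1)) :
    grusinLength γ = grusinLength δ := by
  refine lintegral_congr_ae ?_
  rw [← restrict_Ioo_eq_restrict_Icc]
  refine (ae_restrict_iff' measurableSet_Ioo).2 (Filter.Eventually.of_forall fun t ht => ?_)
  have h1 : γ =ᶠ[nhds t] δ := Filter.eventually_of_mem (isOpen_Ioo.mem_nhds ht)
    fun s hs => h (Ioo_subset_Icc_self hs)
  simp only [h1.eq_of_nhds, h1.deriv_eq]

/-- A curve with velocity `(v, η |γ₁|²)` of constant speed. -/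
theorem grusinLength_eq_of_hasDerivAt {n : ℕ} {γ : ℝ → GrusinSpace n}
    {v : ℝ → EuclideanSpace ℝ (Fin n)} {η A : ℝ}
    (h : ∀ t, HasDerivAt γ (v t, η * ‖(γ t).1‖ ^ 2) t)
    (hA : ∀ t, ‖v t‖ ^ 2 + η ^ 2 * ‖(γ t).1‖ ^ 2 = A) :
    grusinLength γ = ENNReal.ofReal (Real.sqrt A) := by
  have hA0 : 0 ≤ A := by rw [← hA 0]; positivity
  have h1 : ∀ t, horizontalNormSq (grusinField n) (γ t) (deriv γ t) ^ (1 / 2 : ℝ) =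
      ENNReal.ofReal (Real.sqrt A) := fun t => by
    rw [(h t).deriv, horizontalNormSq_eq (η := η) rfl, hA t,
      ENNReal.ofReal_rpow_of_nonneg hA0 (by norm_num), ← Real.sqrt_eq_rpow]
  simp only [grusinLength, horizontalLength, h1]
  simp

/-! ### The explicit curves -/

theorem hasDerivAt_grusinCurve {n : ℕ} (p : GrusinSpace n) {b : ℝ} (hb : b ≠ 0)
    (c : EuclideanSpace ℝ (Fin n)) (t : ℝ) :
    HasDerivAt (grusinCurve p b c) (Real.cos (b * t) • c - (b * Real.sin (b * t)) • p.1,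
      b * ‖(grusinCurve p b c t).1‖ ^ 2) t := by
  have hbt : HasDerivAt (fun t => b * t) b t := by simpa using (hasDerivAt_id t).const_mul b
  have h2bt : HasDerivAt (fun t => 2 * b * t) (2 * b) t := by
    simpa using (hasDerivAt_id t).const_mul (2 * b)
  have hs := hbt.sin
  have hc := hbt.cos
  have hs2 := h2bt.sin
  have e : grusinCurve p b c = fun t => ((Real.sin (b * t) / b) • c + Real.cos (b * t) • p.1,
      ‖c‖ ^ 2 / b * (t / 2 - Real.sin (2 * b * t) / (4 * b))
        + inner ℝ p.1 c / b * Real.sin (b * t) ^ 2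
        + ‖p.1‖ ^ 2 * b * (t / 2 + Real.sin (2 * b * t) / (4 * b)) + p.2) := by
    ext1 t
    simp [grusinCurve, hb]
  rw [e]
  refine HasDerivAt.prodMk ?_ ?_
  · refine (((hs.div_const b).smul_const c).add (hc.smul_const p.1)).congr_deriv ?_
    rw [mul_div_cancel_right₀ _ hb, sub_eq_add_neg, ← neg_smul]
    congr 2
    ring
  · have ht := (hasDerivAt_id t).div_const (2 : ℝ)
    have h4 := hs2.div_const (4 * b)
    refine (((((ht.sub h4).const_mul (‖c‖ ^ 2 / b)).add
      ((hs.pow 2).const_mul (inner ℝ p.1 c / b))).add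
      ((ht.add h4).const_mul (‖p.1‖ ^ 2 * b))).add_const p.2).congr_deriv ?_
    simp only []
    rw [norm_add_sq_real, norm_smul, norm_smul, mul_pow, mul_pow, Real.norm_eq_abs,
      Real.norm_eq_abs, sq_abs, sq_abs, inner_smul_left, inner_smul_right, real_inner_comm,
      mul_assoc 2 b t, Real.cos_two_mul]
    have hsc := Real.sin_sq_add_cos_sq (b * t)
    have hsc' : Real.sin (b * t) ^ 2 = 1 - Real.cos (b * t) ^ 2 := by linarith
    simp only [RCLike.conj_to_real, div_pow, hsc']
    field_simp
    push_cast
    ring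

theorem grusinCurve_norm_sq {n : ℕ} (p : GrusinSpace n) {b : ℝ} (hb : b ≠ 0)
    (c : EuclideanSpace ℝ (Fin n)) (t : ℝ) :
    ‖Real.cos (b * t) • c - (b * Real.sin (b * t)) • p.1‖ ^ 2
      + b ^ 2 * ‖(grusinCurve p b c t).1‖ ^ 2 = ‖c‖ ^ 2 + b ^ 2 * ‖p.1‖ ^ 2 := by
  simp only [grusinCurve, hb, if_false]
  rw [norm_add_sq_real, norm_sub_sq_real]
  simp only [norm_smul, mul_pow, Real.norm_eq_abs, sq_abs, inner_smul_left, inner_smul_right,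
    RCLike.conj_to_real, div_pow]
  have hsc' : Real.sin (b * t) ^ 2 = 1 - Real.cos (b * t) ^ 2 := by
    linarith [Real.sin_sq_add_cos_sq (b * t)]
  rw [hsc']
  field_simp
  ring

theorem grusinLength_grusinCurve {n : ℕ} (p : GrusinSpace n) {b : ℝ} (hb : b ≠ 0)
    (c : EuclideanSpace ℝ (Fin n)) :
    grusinLength (grusinCurve p b c) =
      ENNReal.ofReal (Real.sqrt (‖c‖ ^ 2 + b ^ 2 * ‖p.1‖ ^ 2)) :=
  grusinLength_eq_of_hasDerivAt (hasDerivAt_grusinCurve p hb c) (grusinCurve_norm_sq p hb c)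

theorem isHorizontalCurve_grusinCurve {n : ℕ} (p : GrusinSpace n) {b : ℝ} (hb : b ≠ 0)
    (c : EuclideanSpace ℝ (Fin n)) :
    IsHorizontalCurve (grusinField n) (grusinCurve p b c) := by
  refine ⟨?_, Filter.Eventually.of_forall fun t => ?_⟩
  · have hd := hasDerivAt_grusinCurve p hb c
    have hcont : Continuous (grusinCurve p b c) :=
      continuous_iff_continuousAt.2 fun t => (hd t).continuousAt
    refine ContDiffOn.absolutelyContinuousOnInterval (ContDiff.contDiffOn ?_)
    refine contDiff_one_iff_deriv.2 ⟨fun t => (hd t).differentiableAt, ?_⟩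
    rw [funext fun t => (hd t).deriv]
    fun_prop
  · rw [(hasDerivAt_grusinCurve p hb c t).deriv]
    exact mem_span_grusinField (η := b) rfl

theorem isGrusinGeodesic_grusinCurve {n : ℕ} (p : GrusinSpace n) {b : ℝ} (hb : b ≠ 0)
    (c : EuclideanSpace ℝ (Fin n)) : IsGrusinGeodesic (grusinCurve p b c) := by
  refine ⟨fun t => Real.cos (b * t) • c - (b * Real.sin (b * t)) • p.1, fun _ => b,
    fun t _ => ?_⟩
  have hd := hasDerivAt_grusinCurve p hb c t
  refine ⟨hd.prodFst.hasDerivWithinAt, hd.prodSnd.hasDerivWithinAt, HasDerivAt.hasDerivWithinAt ?_,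
    hasDerivWithinAt_const _ _ _⟩
  have hbt : HasDerivAt (fun t => b * t) b t := by simpa using (hasDerivAt_id t).const_mul b
  refine ((hbt.cos.smul_const c).sub ((hbt.sin.const_mul b).smul_const p.1)).congr_deriv ?_
  simp only [grusinCurve, hb, if_false, smul_add, smul_smul, neg_add, ← neg_smul, sub_eq_add_neg]
  congr 2
  · field_simp
  · ring

theorem grusinCurve_zero {n : ℕ} (p : GrusinSpace n) (b : ℝ) (c : EuclideanSpace ℝ (Fin n)) :
    grusinCurve p b c 0 = p := by
  by_cases hb : b = 0 <;> simp [grusinCurve, hb]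

theorem eqOn_const_of_hasDerivWithinAt_zero {E : Type*} [NormedAddCommGroup E] [NormedSpace ℝ E]
    {f : ℝ → E} (h : ∀ t ∈ Icc (0 : ℝ) 1, HasDerivWithinAt f 0 (Icc 0 1) t) :
    ∀ t ∈ Icc (0 : ℝ) 1, f t = f 0 :=
  constant_of_derivWithin_zero (fun t ht => (h t ht).differentiableWithinAt) fun t ht =>
    (h t (Ico_subset_Icc_self ht)).derivWithin
      (uniqueDiffOn_Icc zero_lt_one t (Ico_subset_Icc_self ht))

/-- Every geodesic is one of the explicit curves. The function `η` is a constant `b`, and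
`cos(bt) γ₁ - b⁻¹ sin(bt) γ₁'` and `b sin(bt) γ₁ + cos(bt) γ₁'` are constants of motion. -/
theorem IsGrusinGeodesic.exists_eqOn_grusinCurve {n : ℕ} {γ : ℝ → GrusinSpace n}
    (hγ : IsGrusinGeodesic γ) :
    ∃ (b : ℝ) (c : EuclideanSpace ℝ (Fin n)), EqOn γ (grusinCurve (γ 0) b c) (Icc 0 1) := by
  obtain ⟨v, η, h⟩ := hγ
  have hη := eqOn_const_of_hasDerivWithinAt_zero fun t ht => (h t ht).2.2.2
  set b := η 0 with hbdef
  refine ⟨b, v 0, ?_⟩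
  have h1 : ∀ t ∈ Icc (0 : ℝ) 1,
      HasDerivWithinAt (fun s => (γ s).1) (v t) (Icc 0 1) t := fun t ht => (h t ht).1
  have h2 : ∀ t ∈ Icc (0 : ℝ) 1, HasDerivWithinAt (fun s => (γ s).2) (b * ‖(γ t).1‖ ^ 2)
      (Icc 0 1) t := fun t ht => hη t ht ▸ (h t ht).2.1
  have h3 : ∀ t ∈ Icc (0 : ℝ) 1, HasDerivWithinAt v (-(b ^ 2 • (γ t).1)) (Icc 0 1) t :=
    fun t ht => hη t ht ▸ (h t ht).2.2.1
  by_cases hb : b = 0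
  · simp only [hb, zero_mul, ne_eq, OfNat.ofNat_ne_zero, not_false_eq_true, zero_pow, zero_smul,
      neg_zero] at h2 h3
    have hv := eqOn_const_of_hasDerivWithinAt_zero h3
    have hf := eqOn_const_of_hasDerivWithinAt_zero (f := fun t => (γ t).1 - t • v 0)
      fun t ht => by
        refine ((h1 t ht).sub
          ((hasDerivAt_id t).smul_const (v 0)).hasDerivWithinAt).congr_deriv ?_
        rw [hv t ht, one_smul, sub_self]
    have hu := eqOn_const_of_hasDerivWithinAt_zero h2
    intro t ht
    refine Prod.ext ?_ ?_
    · simpa [grusinCurve, hb, sub_eq_iff_eq_add, add_comm] using hf t ht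
    · simpa [grusinCurve, hb] using hu t ht
  · have hbt : ∀ t, HasDerivAt (fun t => b * t) b t := fun t => by
      simpa using (hasDerivAt_id t).const_mul b
    have hA := eqOn_const_of_hasDerivWithinAt_zero
      (f := fun t => Real.cos (b * t) • (γ t).1 - (Real.sin (b * t) / b) • v t) fun t ht => by
        refine (((hbt t).cos.hasDerivWithinAt.smul (h1 t ht)).sub
          (((hbt t).sin.div_const b).hasDerivWithinAt.smul (h3 t ht))).congr_deriv ?_
        match_scalars <;> field_simp <;> ring
    have hB := eqOn_const_of_hasDerivWithinAt_zero
      (f := fun t => (b * Real.sin (b * t)) • (γ t).1 + Real.cos (b * t) • v t) fun t ht => by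
        refine ((((hbt t).sin.const_mul b).hasDerivWithinAt.smul (h1 t ht)).add
          ((hbt t).cos.hasDerivWithinAt.smul (h3 t ht))).congr_deriv ?_
        match_scalars <;> ring
    have hfst : ∀ t ∈ Icc (0 : ℝ) 1, (γ t).1 = (grusinCurve (γ 0) b (v 0) t).1 := fun t ht => by
      have hAt := hA t ht
      have hBt := hB t ht
      simp only [mul_zero, Real.cos_zero, Real.sin_zero, zero_div, zero_smul, one_smul, sub_zero,
        zero_add] at hAt hBt
      simp only [grusinCurve, hb, if_false]
      rw [← hAt, ← hBt]
      have hsc : Real.sin (b * t) ^ 2 = 1 - Real.cos (b * t) ^ 2 := by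
        linarith [Real.sin_sq_add_cos_sq (b * t)]
      match_scalars
      · field_simp
        rw [hsc]
        ring
      · field_simp
        ring
    have hsnd := eqOn_const_of_hasDerivWithinAt_zero
      (f := fun t => (γ t).2 - (grusinCurve (γ 0) b (v 0) t).2) fun t ht => by
        refine ((h2 t ht).sub
          (hasDerivAt_grusinCurve (γ 0) hb (v 0) t).prodSnd.hasDerivWithinAt).congr_deriv ?_
        rw [hfst t ht, sub_self]
    intro t ht
    refine Prod.ext (hfst t ht) ?_
    have := hsnd t ht
    simp only [grusinCurve_zero, sub_self] at this
    exact sub_eq_zero.1 this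

/-! ### Absolutely continuous curves -/

theorem AbsolutelyContinuousOnInterval.comp_lipschitzOnWith {X Y : Type*} [PseudoMetricSpace X]
    [PseudoMetricSpace Y] {f : ℝ → X} {φ : X → Y} {K : NNReal} {s : Set X} {a b : ℝ}
    (hf : AbsolutelyContinuousOnInterval f a b) (hφ : LipschitzOnWith K φ s)
    (hs : MapsTo f (uIcc a b) s) : AbsolutelyContinuousOnInterval (fun t => φ (f t)) a b := by
  have hf' := Filter.Tendsto.const_mul (K : ℝ) hf
  rw [mul_zero] at hf'
  refine squeeze_zero' (Filter.Eventually.of_forall fun E =>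
    Finset.sum_nonneg fun _ _ => dist_nonneg) ?_ hf'
  refine Filter.eventually_inf_principal.2 (Filter.Eventually.of_forall fun E hE => ?_)
  rw [Finset.mul_sum]
  exact Finset.sum_le_sum fun i hi => hφ.dist_le_mul _ (hs (hE.1 i hi).1) _ (hs (hE.1 i hi).2)

theorem AbsolutelyContinuousOnInterval.prodMk {X Y : Type*} [PseudoMetricSpace X]
    [PseudoMetricSpace Y] {f : ℝ → X} {g : ℝ → Y} {a b : ℝ}
    (hf : AbsolutelyContinuousOnInterval f a b) (hg : AbsolutelyContinuousOnInterval g a b) :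
    AbsolutelyContinuousOnInterval (fun t => (f t, g t)) a b := by
  have h := Filter.Tendsto.add hf hg
  rw [add_zero] at h
  refine squeeze_zero (fun E => Finset.sum_nonneg fun _ _ => dist_nonneg) (fun E => ?_) h
  rw [← Finset.sum_add_distrib]
  exact Finset.sum_le_sum fun i _ => by
    rw [Prod.dist_eq]
    exact max_le_add_of_nonneg dist_nonneg dist_nonneg

theorem AbsolutelyContinuousOnInterval.ae_differentiableAt_grusinSpace {n : ℕ}
    {γ : ℝ → GrusinSpace n} {a b : ℝ} (hγ : AbsolutelyContinuousOnInterval γ a b) :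
    ∀ᵐ t, t ∈ uIcc a b → DifferentiableAt ℝ γ t := by
  have hlin : ∀ L : GrusinSpace n →L[ℝ] ℝ,
      ∀ᵐ t, t ∈ uIcc a b → DifferentiableAt ℝ (fun s => L (γ s)) t := fun L =>
    (hγ.comp_lipschitzOnWith (L.lipschitz.lipschitzOnWith (s := univ))
      (mapsTo_univ _ _)).ae_differentiableAt
  have h1 := ae_all_iff.2 fun j : Fin n =>
    hlin ((EuclideanSpace.proj j).comp (ContinuousLinearMap.fst ℝ _ ℝ))
  filter_upwards [h1, hlin (ContinuousLinearMap.snd ℝ _ ℝ)] with t h1 h2 ht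
  exact DifferentiableAt.prodMk (f₁ := fun s => (γ s).1) (f₂ := fun s => (γ s).2)
    (differentiableAt_euclidean.2 fun j => h1 j ht) (h2 ht)

/-! ### A calibration of the length -/

/-- The calibration, a function `Φ(τ, (p, u))` of time and position. With `θ = b (τ - 1 / 2)` and
`q = (sin θ p + y) / cos θ`, its derivatives are `∂_τ Φ = -b² (|q|² + |p|²)`, `∂_p Φ = -2 b q` and
`∂_u Φ = 2 b`, so that completing squares gives `∂_τ Φ + dΦ(v) ≤ |v|²` for horizontal `v`. For
`y = x / sin (b / 2)`, equality holds along the extremal with `p = -sin θ y`, which runs from `x` to `-x`. -/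
noncomputable def grusinCalibration {n : ℕ} (b : ℝ) (y : EuclideanSpace ℝ (Fin n))
    (z : ℝ × GrusinSpace n) : ℝ :=
  2 * b * z.2.2 - b * (((‖z.2.1‖ ^ 2 + ‖y‖ ^ 2) * Real.sin (b * (z.1 - 1 / 2))
    + 2 * inner ℝ z.2.1 y) / Real.cos (b * (z.1 - 1 / 2)))

theorem cos_mul_sub_half_pos {b τ : ℝ} (hb : b ∈ Ioo 0 Real.pi) (hτ : τ ∈ Icc (0 : ℝ) 1) :
    0 < Real.cos (b * (τ - 1 / 2)) := by
  obtain ⟨hb0, hb1⟩ := hb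
  obtain ⟨h0, h1⟩ := hτ
  exact Real.cos_pos_of_mem_Ioo ⟨by nlinarith, by nlinarith⟩

/-- The Hamilton-Jacobi inequality along a curve run with the time parameter `τ`. -/
theorem exists_hasDerivAt_grusinCalibration_le {n : ℕ} {b : ℝ} {y : EuclideanSpace ℝ (Fin n)}
    {τ : ℝ → ℝ} {γ : ℝ → GrusinSpace n} {t τ' : ℝ} {v : GrusinSpace n}
    (hτ : HasDerivAt τ τ' t) (hγ : HasDerivAt γ v t) (hτ' : 0 < τ')
    (hcos : Real.cos (b * (τ t - 1 / 2)) ≠ 0) (hv : (γ t).1 = 0 → v.2 = 0) :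
    ∃ D, HasDerivAt (fun s => grusinCalibration b y (τ s, γ s)) D t ∧
      D ≤ (‖v.1‖ ^ 2 + v.2 ^ 2 / ‖(γ t).1‖ ^ 2) / τ' := by
  have hθ : HasDerivAt (fun s => b * (τ s - 1 / 2)) (b * τ') t := (hτ.sub_const _).const_mul b
  have hp := hγ.prodFst
  have hD := (hγ.prodSnd.const_mul (2 * b)).sub (((((hp.norm_sq.add_const (‖y‖ ^ 2)).mul
    hθ.sin).add ((hp.inner ℝ (hasDerivAt_const t y)).const_mul 2)).div hθ.cos hcos).const_mul b)
  refine ⟨_, hD, ?_⟩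
  set p := (γ t).1 with hpdef
  set S := Real.sin (b * (τ t - 1 / 2))
  set C := Real.cos (b * (τ t - 1 / 2))
  have hSC : S ^ 2 = 1 - C ^ 2 := by
    linarith [Real.sin_sq_add_cos_sq (b * (τ t - 1 / 2))]
  -- The square that is completed in the directions of the first summand.
  have hq : 0 ≤ ‖v.1 + (b * τ' / C) • (S • p + y)‖ ^ 2 := sq_nonneg _
  rw [norm_add_sq_real, norm_smul, mul_pow, Real.norm_eq_abs, sq_abs, inner_smul_right,
    inner_add_right, inner_smul_right, norm_add_sq_real, norm_smul, mul_pow, Real.norm_eq_abs,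
    sq_abs, inner_smul_left, real_inner_comm p v.1] at hq
  -- The square that is completed in the direction of the second summand.
  have hu : 2 * b * v.2 * τ' - b ^ 2 * τ' ^ 2 * ‖p‖ ^ 2 ≤ v.2 ^ 2 / ‖p‖ ^ 2 := by
    rcases eq_or_ne p 0 with h0 | h0
    · simp [h0, hv h0]
    · have hn : 0 < ‖p‖ ^ 2 := by positivity
      rw [le_div_iff₀ hn]
      nlinarith [sq_nonneg (v.2 - b * τ' * ‖p‖ ^ 2)]
  rw [le_div_iff₀ hτ']
  refine (le_of_eq ?_).trans (add_le_add (sub_le_self (‖v.1‖ ^ 2) hq) hu)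
  simp only [Pi.add_apply, Pi.mul_apply, inner_zero_right, RCLike.conj_to_real, ← hpdef,
    show Real.sin (b * (τ t - 1 / 2)) = S from rfl]
  field_simp
  linear_combination (-(b ^ 2 * τ' ^ 2 * ‖y‖ ^ 2)) * hSC

/-- The speed of a curve, as a real number. At the singular points the second term is the junk
value `0`, which is right for horizontal curves. -/
noncomputable def grusinSpeed {n : ℕ} (γ : ℝ → GrusinSpace n) (t : ℝ) : ℝ :=
  Real.sqrt (‖(deriv γ t).1‖ ^ 2 + (deriv γ t).2 ^ 2 / ‖(γ t).1‖ ^ 2)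

theorem lintegral_grusinSpeed_le {n : ℕ} (γ : ℝ → GrusinSpace n) :
    ∫⁻ t in Icc (0 : ℝ) 1, ENNReal.ofReal (grusinSpeed γ t) ≤ grusinLength γ := by
  refine lintegral_mono fun t => ?_
  rw [grusinSpeed, Real.sqrt_eq_rpow,
    ← ENNReal.ofReal_rpow_of_nonneg (by positivity) (by norm_num)]
  exact ENNReal.rpow_le_rpow (ofReal_le_horizontalNormSq _ _) (by norm_num)

theorem integrableOn_grusinSpeed {n : ℕ} {γ : ℝ → GrusinSpace n}
    (hγ : AbsolutelyContinuousOnInterval γ 0 1) (hL : grusinLength γ ≠ ∞) :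
    IntegrableOn (grusinSpeed γ) (Icc 0 1) := by
  have hcont := hγ.continuousOn
  rw [uIcc_of_le zero_le_one] at hcont
  have hm : AEMeasurable γ (volume.restrict (Icc 0 1)) := hcont.aemeasurable measurableSet_Icc
  have hd : AEMeasurable (deriv γ) (volume.restrict (Icc 0 1)) := (measurable_deriv γ).aemeasurable
  refine ⟨AEMeasurable.aestronglyMeasurable ?_, ?_⟩
  · exact (((hd.fst.norm.pow_const 2).add ((hd.snd.pow_const 2).div
      (hm.fst.norm.pow_const 2)))).sqrt
  · rw [hasFiniteIntegral_iff_ofReal (f := grusinSpeed γ)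
      (Filter.Eventually.of_forall fun t => Real.sqrt_nonneg _)]
    exact (lintegral_grusinSpeed_le γ).trans_lt hL.lt_top

theorem ofReal_integral_grusinSpeed_le {n : ℕ} {γ : ℝ → GrusinSpace n}
    (hγ : AbsolutelyContinuousOnInterval γ 0 1) (hL : grusinLength γ ≠ ∞) :
    ENNReal.ofReal (∫ t in (0 : ℝ)..1, grusinSpeed γ t) ≤ grusinLength γ := by
  rw [intervalIntegral.integral_of_le zero_le_one, ← integral_Icc_eq_integral_Ioc,
    ofReal_integral_eq_lintegral_ofReal (integrableOn_grusinSpeed hγ hL)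
      (Filter.Eventually.of_forall fun t => Real.sqrt_nonneg _)]
  exact lintegral_grusinSpeed_le γ

theorem absolutelyContinuousOnInterval_grusinCalibration {n : ℕ} {b : ℝ}
    (hb : b ∈ Ioo 0 Real.pi) (y : EuclideanSpace ℝ (Fin n)) {τ : ℝ → ℝ} {γ : ℝ → GrusinSpace n}
    (hτ : AbsolutelyContinuousOnInterval τ 0 1) (hτ01 : MapsTo τ (Icc 0 1) (Icc 0 1))
    (hγ : AbsolutelyContinuousOnInterval γ 0 1) :
    AbsolutelyContinuousOnInterval (fun t => grusinCalibration b y (τ t, γ t)) 0 1 := by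
  obtain ⟨R, hR⟩ := hγ.exists_bound
  have hdiff : ContDiffOn ℝ 1 (grusinCalibration b y)
      (Icc (0 : ℝ) 1 ×ˢ Metric.closedBall (0 : GrusinSpace n) R) := by
    unfold grusinCalibration
    refine ContDiffOn.sub (by fun_prop) (contDiffOn_const.mul (ContDiffOn.div ?_ (by fun_prop)
      fun z hz => (cos_mul_sub_half_pos hb hz.1).ne'))
    refine ContDiffOn.add (ContDiffOn.mul (ContDiffOn.add ?_ contDiffOn_const) (by fun_prop))
      (contDiffOn_const.mul (ContDiffOn.inner ℝ (by fun_prop) contDiffOn_const))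
    exact ContDiffOn.norm_sq ℝ (by fun_prop)
  obtain ⟨K, hK⟩ := hdiff.exists_lipschitzOnWith one_ne_zero
    ((convex_Icc _ _).prod (convex_closedBall _ _))
    (isCompact_Icc.prod (isCompact_closedBall _ _))
  refine (hτ.prodMk hγ).comp_lipschitzOnWith hK fun t ht => ⟨hτ01 ?_, ?_⟩
  · rwa [uIcc_of_le zero_le_one] at ht
  · simpa using hR t ht

/-- The inequality `Φ(1, γ 1) - Φ(0, γ 0) ≤ (∫ speed)²`. The curve is run with its normalized
arclength as time; adding `ε t` to the arclength makes this time parameter regular. -/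
theorem grusinCalibration_sub_le {n : ℕ} {b : ℝ} (hb : b ∈ Ioo 0 Real.pi)
    (y : EuclideanSpace ℝ (Fin n)) {γ : ℝ → GrusinSpace n}
    (hγ : IsHorizontalCurve (grusinField n) γ) (hL : grusinLength γ ≠ ∞) :
    grusinCalibration b y (1, γ 1) - grusinCalibration b y (0, γ 0) ≤
      (∫ t in (0 : ℝ)..1, grusinSpeed γ t) ^ 2 := by
  set g := grusinSpeed γ with hg
  set Λ := ∫ t in (0 : ℝ)..1, g t with hΛ
  have hg0 : ∀ t, 0 ≤ g t := fun t => Real.sqrt_nonneg _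
  have hint : IntervalIntegrable g volume 0 1 :=
    (intervalIntegrable_iff_integrableOn_Icc_of_le zero_le_one).2
      (integrableOn_grusinSpeed hγ.1 hL)
  have hΛ0 : 0 ≤ Λ := intervalIntegral.integral_nonneg zero_le_one fun t _ => hg0 t
  suffices h : ∀ ε > 0, grusinCalibration b y (1, γ 1) - grusinCalibration b y (0, γ 0) ≤
      Λ * (Λ + ε) by
    have hlim : Filter.Tendsto (fun ε => Λ * (Λ + ε)) (nhdsWithin 0 (Ioi 0)) (nhds (Λ ^ 2)) := by
      have : Continuous fun ε => Λ * (Λ + ε) := by fun_prop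
      have := (this.tendsto 0).mono_left (nhdsWithin_le_nhds (s := Ioi 0))
      rwa [add_zero, ← sq] at this
    exact ge_of_tendsto hlim (eventually_mem_nhdsWithin.mono h)
  intro ε hε
  have hΛε : 0 < Λ + ε := by positivity
  set τ : ℝ → ℝ := fun t => (∫ s in (0 : ℝ)..t, g s + ε) / (Λ + ε) with hτ
  have hintε : IntervalIntegrable (fun s => g s + ε) volume 0 1 :=
    hint.add intervalIntegrable_const
  have htot : ∫ s in (0 : ℝ)..1, g s + ε = Λ + ε := by
    rw [intervalIntegral.integral_add hint intervalIntegrable_const]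
    simp [hΛ]
  have hτ0 : τ 0 = 0 := by simp [hτ]
  have hτ1 : τ 1 = 1 := by simp only [hτ, htot]; exact div_self hΛε.ne'
  have hτ01 : MapsTo τ (Icc 0 1) (Icc 0 1) := fun t ht => by
    have h0 : ∀ s, 0 ≤ g s + ε := fun s => add_nonneg (hg0 s) hε.le
    refine ⟨div_nonneg (intervalIntegral.integral_nonneg ht.1 fun s _ => h0 s) hΛε.le,
      (div_le_one hΛε).2 ?_⟩
    rw [← htot]
    exact intervalIntegral.integral_mono_interval le_rfl ht.1 ht.2
      (Filter.Eventually.of_forall h0) hintε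
  have hτac : AbsolutelyContinuousOnInterval τ 0 1 := by
    have := (hintε.absolutelyContinuousOnInterval_intervalIntegral
      (c := 0) left_mem_uIcc).const_mul (Λ + ε)⁻¹
    simpa only [hτ, div_eq_inv_mul] using this
  have hF := absolutelyContinuousOnInterval_grusinCalibration hb y hτac hτ01 hγ.1
  have hFTC := hF.integral_deriv_eq_sub
  simp only [hτ0, hτ1] at hFTC
  rw [← hFTC, hΛ, ← intervalIntegral.integral_mul_const]
  refine intervalIntegral.integral_mono_ae_restrict zero_le_one hF.intervalIntegrable_deriv
    (hint.mul_const _) ?_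
  filter_upwards [hγ.2, ae_restrict_of_ae hγ.1.ae_differentiableAt_grusinSpace,
    ae_restrict_of_ae hintε.ae_hasDerivAt_integral, ae_restrict_mem measurableSet_Icc]
    with t hspan hdiff hderiv ht
  have ht' : t ∈ uIcc (0 : ℝ) 1 := by rwa [uIcc_of_le zero_le_one]
  have hgε : 0 < g t + ε := add_pos_of_nonneg_of_pos (hg0 t) hε
  obtain ⟨D, hD, hDle⟩ := exists_hasDerivAt_grusinCalibration_le (b := b) (y := y)
    ((hderiv ht' 0 left_mem_uIcc).div_const (Λ + ε)) (hdiff ht').hasDerivAt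
    (div_pos hgε hΛε) (cos_mul_sub_half_pos hb (hτ01 ht)).ne'
    (fun h0 => snd_eq_zero_of_mem_span h0 hspan)
  rw [hD.deriv]
  refine hDle.trans ?_
  have hsq : ‖(deriv γ t).1‖ ^ 2 + (deriv γ t).2 ^ 2 / ‖(γ t).1‖ ^ 2 = g t ^ 2 :=
    (Real.sq_sqrt (by positivity)).symm
  rw [hsq, div_div_eq_mul_div, div_le_iff₀ hgε]
  nlinarith [mul_nonneg (mul_nonneg (hg0 t) hε.le) hΛε.le]

theorem grusinCalibration_antipodal {n : ℕ} {b : ℝ} (hb : b ∈ Ioo 0 Real.pi)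
    (x : EuclideanSpace ℝ (Fin n)) (u : ℝ) :
    grusinCalibration b ((Real.sin (b / 2))⁻¹ • x) (1, (-x, u))
      - grusinCalibration b ((Real.sin (b / 2))⁻¹ • x) (0, (x, 0))
      = 2 * b * u + 2 * ‖x‖ ^ 2 * b * Real.cot (b / 2) := by
  have hs : Real.sin (b / 2) ≠ 0 :=
    (Real.sin_pos_of_mem_Ioo ⟨by linarith [hb.1], by linarith [hb.1, hb.2]⟩).ne'
  have hc : Real.cos (b / 2) ≠ 0 :=
    (Real.cos_pos_of_mem_Ioo ⟨by linarith [hb.1, Real.pi_pos], by linarith [hb.2]⟩).ne'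
  simp only [grusinCalibration]
  rw [show b * (1 - 1 / 2) = b / 2 by ring, show b * (0 - 1 / 2) = -(b / 2) by ring,
    Real.sin_neg, Real.cos_neg, Real.cot_eq_cos_div_sin, norm_neg, inner_neg_left,
    inner_smul_right, real_inner_self_eq_norm_sq, norm_smul, mul_pow, Real.norm_eq_abs, sq_abs,
    mul_zero]
  have hsc : Real.sin (b / 2) ^ 2 = 1 - Real.cos (b / 2) ^ 2 := by
    linarith [Real.sin_sq_add_cos_sq (b / 2)]
  field_simp
  rw [hsc]
  ring

theorem ofReal_sqrt_le_grusinLength {n : ℕ} {b : ℝ} (hb : b ∈ Ioo 0 Real.pi)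
    {x : EuclideanSpace ℝ (Fin n)} {u : ℝ} {γ : ℝ → GrusinSpace n}
    (hγ : IsHorizontalCurve (grusinField n) γ) (h0 : γ 0 = (x, 0)) (h1 : γ 1 = (-x, u)) :
    ENNReal.ofReal (Real.sqrt (2 * b * u + 2 * ‖x‖ ^ 2 * b * Real.cot (b / 2))) ≤
      grusinLength γ := by
  rcases eq_or_ne (grusinLength γ) ∞ with hL | hL
  · rw [hL]
    exact le_top
  · refine le_trans (ENNReal.ofReal_le_ofReal ?_) (ofReal_integral_grusinSpeed_le hγ.1 hL)
    refine Real.sqrt_le_iff.2 ⟨intervalIntegral.integral_nonneg zero_le_one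
      fun t _ => Real.sqrt_nonneg _, ?_⟩
    have := grusinCalibration_sub_le hb ((Real.sin (b / 2))⁻¹ • x) hγ hL
    rwa [h0, h1, grusinCalibration_antipodal hb] at this

/-! ### Geodesics between antipodal points -/

theorem IsMuTildeSolution.pos {n : ℕ} {x : EuclideanSpace ℝ (Fin n)} {u b : ℝ}
    (h : IsMuTildeSolution x u b) (hx : x ≠ 0) (hu : 0 < u) : 0 < b := by
  have : 0 < b / 2 := pos_of_muTilde_pos (h.2 ▸ div_pos hu (by positivity))
  linarith

theorem IsMuTildeSolution.sin_ne_zero {n : ℕ} {x : EuclideanSpace ℝ (Fin n)} {u b : ℝ}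
    (h : IsMuTildeSolution x u b) (hx : x ≠ 0) (hu : 0 < u) : Real.sin (b / 2) ≠ 0 := by
  intro h0
  obtain ⟨k, hk⟩ := Real.sin_eq_zero_iff.1 h0
  refine h.1 k ?_ hk.symm
  rintro rfl
  have := h.pos hx hu
  simp at hk
  linarith

theorem IsMuTildeSolution.norm_sq_mul {n : ℕ} {x : EuclideanSpace ℝ (Fin n)} {u b : ℝ}
    (h : IsMuTildeSolution x u b) (hx : x ≠ 0) : ‖x‖ ^ 2 * muTilde (b / 2) = u := by
  rw [← h.2, mul_div_cancel₀]
  exact pow_ne_zero 2 (norm_ne_zero_iff.2 hx)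

theorem isMuTildeSolution_of_sin_ne_zero {n : ℕ} {x : EuclideanSpace ℝ (Fin n)} {u b : ℝ}
    (hs : Real.sin (b / 2) ≠ 0) (hx : x ≠ 0) (h : ‖x‖ ^ 2 * muTilde (b / 2) = u) :
    IsMuTildeSolution x u b := by
  refine ⟨fun k _ hk => hs (by rw [hk, Real.sin_int_mul_pi]), ?_⟩
  rw [← h, mul_div_cancel_left₀]
  exact pow_ne_zero 2 (norm_ne_zero_iff.2 hx)

theorem antipodalCurve_one {n : ℕ} (x : EuclideanSpace ℝ (Fin n)) {b : ℝ} (hb : b ≠ 0)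
    (hs : Real.sin (b / 2) ≠ 0) :
    antipodalCurve x b 1 = (-x, ‖x‖ ^ 2 * muTilde (b / 2)) := by
  have h1 : Real.sin b = 2 * Real.sin (b / 2) * Real.cos (b / 2) := by
    rw [← Real.sin_two_mul]; congr 1; ring
  have h2 : Real.cos b = 2 * Real.cos (b / 2) ^ 2 - 1 := by
    rw [← Real.cos_two_mul]; congr 1; ring
  simp only [antipodalCurve, grusinCurve, hb, if_false, mul_one, add_zero]
  refine Prod.ext ?_ ?_
  · simp only [smul_smul, Real.cot_eq_cos_div_sin]
    match_scalars
    rw [h1, h2]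
    field_simp
    ring
  · simp only [muTilde, Real.cot_eq_cos_div_sin, norm_smul, mul_pow, Real.norm_eq_abs, sq_abs,
      norm_neg, inner_smul_right, inner_neg_right, real_inner_self_eq_norm_sq, neg_smul,
      Real.sin_two_mul b, h1, h2]
    field_simp
    linear_combination (‖x‖ ^ 2 * (4 * b - 8 * Real.cos (b / 2) * Real.sin (b / 2) *
      (2 * Real.cos (b / 2) ^ 2 + 1))) * Real.sin_sq_add_cos_sq (b / 2)

theorem norm_sq_antipodal {n : ℕ} (x : EuclideanSpace ℝ (Fin n)) {b : ℝ}
    (hs : Real.sin (b / 2) ≠ 0) :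
    ‖-(b * Real.cot (b / 2)) • x‖ ^ 2 + b ^ 2 * ‖x‖ ^ 2 =
      b ^ 2 / Real.sin (b / 2) ^ 2 * ‖x‖ ^ 2 := by
  rw [norm_smul, mul_pow, Real.norm_eq_abs, sq_abs, Real.cot_eq_cos_div_sin]
  field_simp
  linear_combination (b ^ 2 * ‖x‖ ^ 2) * (Real.sin_sq_add_cos_sq (b / 2))

theorem grusinLength_antipodalCurve {n : ℕ} (x : EuclideanSpace ℝ (Fin n)) {b : ℝ} (hb : b ≠ 0)
    (hs : Real.sin (b / 2) ≠ 0) :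
    grusinLength (antipodalCurve x b) =
      ENNReal.ofReal (Real.sqrt (b ^ 2 / Real.sin (b / 2) ^ 2 * ‖x‖ ^ 2)) := by
  rw [antipodalCurve, grusinLength_grusinCurve _ hb, norm_sq_antipodal x hs]

theorem sq_div_sin_sq_mul_norm_sq {n : ℕ} {x : EuclideanSpace ℝ (Fin n)} {u b : ℝ} (hx : x ≠ 0)
    (h : IsMuTildeSolution x u b) :
    b ^ 2 / Real.sin (b / 2) ^ 2 * ‖x‖ ^ 2 =
      2 * b * u + 2 * ‖x‖ ^ 2 * b * Real.cot (b / 2) := by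
  have := sq_div_sin_sq (b / 2)
  rw [← h.norm_sq_mul hx]
  linear_combination (4 * ‖x‖ ^ 2) * this

theorem isGrusinGeodesicFromTo_antipodalCurve {n : ℕ} {x : EuclideanSpace ℝ (Fin n)} {u b : ℝ}
    (hx : x ≠ 0) (hu : 0 < u) (h : IsMuTildeSolution x u b) :
    IsGrusinGeodesicFromTo (x, 0) (-x, u) (antipodalCurve x b) :=
  ⟨isGrusinGeodesic_grusinCurve _ (h.pos hx hu).ne' _, grusinCurve_zero _ _ _, by
    rw [antipodalCurve_one x (h.pos hx hu).ne' (h.sin_ne_zero hx hu), h.norm_sq_mul hx]⟩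

theorem grusinLength_antipodalCurve_lt {n : ℕ} {x : EuclideanSpace ℝ (Fin n)} {u b b' : ℝ}
    (hx : x ≠ 0) (hu : 0 < u) (h : IsMuTildeSolution x u b) (h' : IsMuTildeSolution x u b')
    (hlt : b < b') :
    grusinLength (antipodalCurve x b) < grusinLength (antipodalCurve x b') := by
  have hs := h.sin_ne_zero hx hu
  have hs' := h'.sin_ne_zero hx hu
  rw [grusinLength_antipodalCurve x (h.pos hx hu).ne' hs,
    grusinLength_antipodalCurve x (h'.pos hx hu).ne' hs',
    ENNReal.ofReal_lt_ofReal_iff_of_nonneg (Real.sqrt_nonneg _)]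
  refine Real.sqrt_lt_sqrt (by positivity) (mul_lt_mul_of_pos_right ?_ (by positivity))
  have := sq_div_sin_sq_lt (div_pos hu (by positivity : 0 < ‖x‖ ^ 2)) hs hs' h.2.symm h'.2.symm
    (by linarith)
  rw [div_pow, div_pow, div_right_comm, div_right_comm (b' ^ 2)] at this
  exact (div_lt_div_iff_of_pos_right (by norm_num)).1 this

theorem grusinCurve_one_of_sin_eq_zero {n : ℕ} (x c : EuclideanSpace ℝ (Fin n)) {b : ℝ}
    (hb : b ≠ 0) (hs : Real.sin b = 0) :
    grusinCurve (x, 0) b c 1 = (Real.cos b • x, (‖c‖ ^ 2 + b ^ 2 * ‖x‖ ^ 2) / (2 * b)) := by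
  simp only [grusinCurve, hb, if_false, mul_one, hs, Real.sin_two_mul b]
  refine Prod.ext (by simp) ?_
  simp only []
  field_simp
  ring

theorem sin_odd_mul_pi (m : ℕ) : Real.sin ((2 * m + 1) * Real.pi) = 0 := by
  simpa using Real.sin_nat_mul_pi (2 * m + 1)

theorem cos_odd_mul_pi (m : ℕ) : Real.cos ((2 * m + 1) * Real.pi) = -1 := by
  rw [add_mul, one_mul, Real.cos_add_pi, mul_assoc, mul_left_comm, Real.cos_nat_mul_two_pi]

theorem sq_radius {m : ℕ} {X u R : ℝ} (hm : (2 * m + 1) * Real.pi * X ^ 2 ≤ 2 * u)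
    (hR : R = Real.sqrt
      (2 * (2 * m + 1) * Real.pi * u - (2 * m + 1) ^ 2 * Real.pi ^ 2 * X ^ 2)) :
    R ^ 2 + ((2 * m + 1) * Real.pi) ^ 2 * X ^ 2 = 2 * (2 * m + 1) * Real.pi * u := by
  have hpi := Real.pi_pos
  rw [hR, Real.sq_sqrt]
  · ring
  · have : 0 ≤ (2 * m + 1) * Real.pi * (2 * u - (2 * m + 1) * Real.pi * X ^ 2) :=
      mul_nonneg (by positivity) (by linarith)
    linarith

theorem isGrusinGeodesicFromTo_grusinCurve_odd {n : ℕ} {x c : EuclideanSpace ℝ (Fin n)} {u : ℝ}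
    {m : ℕ} (hm : (2 * m + 1) * Real.pi * ‖x‖ ^ 2 ≤ 2 * u)
    (hc : ‖c‖ = Real.sqrt
      (2 * (2 * m + 1) * Real.pi * u - (2 * m + 1) ^ 2 * Real.pi ^ 2 * ‖x‖ ^ 2)) :
    IsGrusinGeodesicFromTo (x, 0) (-x, u) (grusinCurve (x, 0) ((2 * m + 1) * Real.pi) c) := by
  have hb : (2 * m + 1) * Real.pi ≠ 0 := by positivity
  refine ⟨isGrusinGeodesic_grusinCurve _ hb _, grusinCurve_zero _ _ _, ?_⟩
  rw [grusinCurve_one_of_sin_eq_zero x c hb (sin_odd_mul_pi m), sq_radius hm hc, cos_odd_mul_pi]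
  refine Prod.ext (by simp) ?_
  simp only []
  field_simp

theorem grusinLength_grusinCurve_odd {n : ℕ} {x c : EuclideanSpace ℝ (Fin n)} {u : ℝ}
    {m : ℕ} (hm : (2 * m + 1) * Real.pi * ‖x‖ ^ 2 ≤ 2 * u)
    (hc : ‖c‖ = Real.sqrt
      (2 * (2 * m + 1) * Real.pi * u - (2 * m + 1) ^ 2 * Real.pi ^ 2 * ‖x‖ ^ 2)) :
    grusinLength (grusinCurve (x, 0) ((2 * m + 1) * Real.pi) c) =
      ENNReal.ofReal (Real.sqrt (2 * (2 * m + 1) * Real.pi * u)) := by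
  rw [grusinLength_grusinCurve _ (by positivity), sq_radius hm hc]

theorem exists_norm_eq_of_ne_zero {E : Type*} [NormedAddCommGroup E] [NormedSpace ℝ E] {x : E}
    (hx : x ≠ 0) {R : ℝ} (hR : 0 ≤ R) : ∃ c : E, ‖c‖ = R :=
  ⟨(R / ‖x‖) • x, by
    rw [norm_smul, Real.norm_of_nonneg (by positivity), div_mul_cancel₀ _ (norm_ne_zero_iff.2 hx)]⟩

/-- The endpoint condition `γ₁(1) = -x` determines `c` unless `sin b = 0`, in which case
`cos b = -1`; the condition `γ₂(1) = u` then determines `b` or `‖c‖`. -/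
theorem IsGrusinGeodesicFromTo.antipodal_cases {n : ℕ} {x : EuclideanSpace ℝ (Fin n)} {u : ℝ}
    (hx : x ≠ 0) (hu : 0 < u) {γ : ℝ → GrusinSpace n}
    (hγ : IsGrusinGeodesicFromTo (x, 0) (-x, u) γ) :
    (∃ b : ℝ, IsMuTildeSolution x u b ∧ EqOn γ (antipodalCurve x b) (Icc 0 1)) ∨
    (∃ (m : ℕ) (c : EuclideanSpace ℝ (Fin n)),
      (2 * m + 1) * Real.pi * ‖x‖ ^ 2 ≤ 2 * u ∧
      ‖c‖ = Real.sqrt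
        (2 * (2 * m + 1) * Real.pi * u - (2 * m + 1) ^ 2 * Real.pi ^ 2 * ‖x‖ ^ 2) ∧
      EqOn γ (grusinCurve (x, 0) ((2 * m + 1) * Real.pi) c) (Icc 0 1)) := by
  obtain ⟨hγ, h0, h1⟩ := hγ
  obtain ⟨b, c, h⟩ := hγ.exists_eqOn_grusinCurve
  rw [h0] at h
  have hend : grusinCurve (x, 0) b c 1 = (-x, u) := by
    rw [← h (right_mem_Icc.2 zero_le_one), h1]
  have hb : b ≠ 0 := by
    rintro rfl
    have := congrArg Prod.snd hend
    simp only [grusinCurve, if_true] at this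
    exact hu.ne this
  by_cases hs : Real.sin b = 0
  · right
    rw [grusinCurve_one_of_sin_eq_zero x c hb hs, Prod.mk.injEq] at hend
    obtain ⟨e1, e2⟩ := hend
    have hcos : Real.cos b = -1 := by
      rw [← neg_one_smul ℝ x] at e1
      exact smul_left_injective ℝ hx e1
    have hb0 : 0 < b := by
      by_contra hneg
      have : (‖c‖ ^ 2 + b ^ 2 * ‖x‖ ^ 2) / (2 * b) ≤ 0 :=
        div_nonpos_of_nonneg_of_nonpos (by positivity) (by linarith)
      linarith
    obtain ⟨k, hk⟩ := Real.cos_eq_neg_one_iff.1 hcos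
    have hk0 : 0 ≤ k := by
      by_contra hneg
      have h1 : (k : ℝ) ≤ -1 := by exact_mod_cast (by omega : k ≤ -1)
      nlinarith [Real.pi_pos]
    obtain ⟨m, rfl⟩ := Int.eq_ofNat_of_zero_le hk0
    have hbm : b = (2 * m + 1) * Real.pi := by
      rw [← hk]
      push_cast
      ring
    rw [div_eq_iff (by positivity)] at e2
    have hc2 : ‖c‖ ^ 2 =
        2 * (2 * m + 1) * Real.pi * u - (2 * m + 1) ^ 2 * Real.pi ^ 2 * ‖x‖ ^ 2 := by
      rw [hbm] at e2
      linear_combination e2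
    refine ⟨m, c, ?_, ?_, hbm ▸ h⟩
    · rw [← hbm]
      have : b * (b * ‖x‖ ^ 2) ≤ b * (2 * u) := by nlinarith [sq_nonneg ‖c‖]
      exact le_of_mul_le_mul_left this hb0
    · rw [← hc2, Real.sqrt_sq (norm_nonneg c)]
  · left
    have h1 : Real.sin b = 2 * Real.sin (b / 2) * Real.cos (b / 2) := by
      rw [← Real.sin_two_mul]; congr 1; ring
    have h2 : Real.cos b = 2 * Real.cos (b / 2) ^ 2 - 1 := by
      rw [← Real.cos_two_mul]; congr 1; ring
    have hs2 : Real.sin (b / 2) ≠ 0 := fun h0 => hs (by rw [h1, h0]; ring)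
    have hc2 : Real.cos (b / 2) ≠ 0 := fun h0 => hs (by rw [h1, h0]; ring)
    have hc : c = -(b * Real.cot (b / 2)) • x := by
      have e1 := congrArg Prod.fst hend
      simp only [grusinCurve, hb, if_false, mul_one] at e1
      have e2 : (Real.sin b / b) • c = (-1 - Real.cos b) • x := by
        rw [sub_smul, neg_one_smul]
        exact eq_sub_of_add_eq e1
      have e3 : c = (b / Real.sin b) • (Real.sin b / b) • c := by
        rw [smul_smul, div_mul_div_cancel₀ hs, div_self hb, one_smul]
      rw [e3, e2, smul_smul, h1, h2, Real.cot_eq_cos_div_sin]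
      congr 1
      field_simp
      ring
    have hcurve : grusinCurve (x, 0) b c = antipodalCurve x b := by rw [hc, antipodalCurve]
    rw [hcurve] at h hend
    rw [antipodalCurve_one x hb hs2, Prod.mk.injEq] at hend
    exact ⟨b, isMuTildeSolution_of_sin_ne_zero hs2 hx hend.2, h⟩

theorem finite_isMuTildeSolution {n : ℕ} {x : EuclideanSpace ℝ (Fin n)} {u : ℝ} (hx : x ≠ 0)
    (hu : 0 < u) : {b : ℝ | IsMuTildeSolution x u b}.Finite := by
  have hK : 0 < u / ‖x‖ ^ 2 := by positivity
  refine ((finite_muTilde_eq hK).preimage (f := fun b => b / 2) fun a _ b _ hab => ?_).subset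
    fun b hb => ⟨hb.sin_ne_zero hx hu, hb.2.symm⟩
  simpa using hab

theorem finite_odd_mul_pi_le {X u : ℝ} (hX : 0 < X) :
    {m : ℕ | (2 * m + 1) * Real.pi * X ≤ 2 * u}.Finite := by
  obtain ⟨N, hN⟩ := exists_nat_gt (2 * u / (Real.pi * X))
  refine (finite_Iio N).subset fun m hm => ?_
  have hpX : 0 < Real.pi * X := mul_pos Real.pi_pos hX
  rw [div_lt_iff₀ hpX] at hN
  have h1 : ((2 * m + 1 : ℝ)) * (Real.pi * X) < N * (Real.pi * X) := by
    rw [← mul_assoc]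
    exact lt_of_le_of_lt hm hN
  have h2 : (2 * m + 1 : ℝ) < N := lt_of_mul_lt_mul_right h1 hpX.le
  have h3 : 2 * m + 1 < N := by exact_mod_cast h2
  exact mem_Iio.2 (by omega)

theorem finite_norm_eq_fin_one (R : ℝ) : {c : EuclideanSpace ℝ (Fin 1) | ‖c‖ = R}.Finite := by
  refine (((finite_singleton (-R)).insert R).preimage
    (f := fun c : EuclideanSpace ℝ (Fin 1) => c 0) fun a _ b _ hab => ?_).subset fun c hc => ?_
  · ext i
    rw [Subsingleton.elim i 0]
    exact hab
  · have h : ‖c‖ = |c 0| := by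
      rw [EuclideanSpace.norm_eq]
      simp [Real.sqrt_sq_eq_abs]
    have hc' : |c 0| = R := h ▸ hc
    rcases abs_choice (c 0) with h1 | h1
    · exact Or.inl (h1.symm.trans hc')
    · exact Or.inr (by rw [mem_singleton_iff, ← hc', h1, neg_neg])

theorem finite_geodesics_antipodal {n : ℕ} {x : EuclideanSpace ℝ (Fin n)} {u : ℝ} (hx : x ≠ 0)
    (hu : 0 < u) (h : n = 1 ∨ 2 * u ≤ Real.pi * ‖x‖ ^ 2) :
    ((fun γ : ℝ → GrusinSpace n => (Icc (0 : ℝ) 1).domRestrict γ) ''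
      {γ | IsGrusinGeodesicFromTo (x, 0) (-x, u) γ}).Finite := by
  have hX : 0 < ‖x‖ ^ 2 := by positivity
  set M := {m : ℕ | (2 * m + 1) * Real.pi * ‖x‖ ^ 2 ≤ 2 * u} with hM
  have hc : ∀ m ∈ M, {c : EuclideanSpace ℝ (Fin n) | ‖c‖ = Real.sqrt
      (2 * (2 * m + 1) * Real.pi * u - (2 * m + 1) ^ 2 * Real.pi ^ 2 * ‖x‖ ^ 2)}.Finite := by
    intro m hm
    rcases h with rfl | h
    · exact finite_norm_eq_fin_one _
    · -- Here `(2m+1)π‖x‖² ≥ π‖x‖² ≥ 2u`, so the radius is zero.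
      refine (finite_singleton 0).subset fun c hc => ?_
      have hp : 0 < (2 * m + 1) * Real.pi := by positivity
      have h1 : 2 * u ≤ (2 * m + 1) * Real.pi * ‖x‖ ^ 2 := by
        refine h.trans (mul_le_mul_of_nonneg_right ?_ hX.le)
        have : (0 : ℝ) ≤ m * Real.pi := by positivity
        linarith
      rw [mem_ofPred_eq, Real.sqrt_eq_zero_of_nonpos] at hc
      · exact norm_eq_zero.1 hc
      · nlinarith [mul_nonneg hp.le (sub_nonneg.2 h1)]
  refine (((finite_isMuTildeSolution hx hu).image
    fun b => (Icc (0 : ℝ) 1).domRestrict (antipodalCurve x b)).union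
    ((finite_odd_mul_pi_le hX).biUnion fun m hm => (hc m hm).image
      fun c => (Icc (0 : ℝ) 1).domRestrict
        (grusinCurve (x, 0) ((2 * m + 1) * Real.pi) c))).subset ?_
  rintro _ ⟨γ, hγ, rfl⟩
  rcases hγ.antipodal_cases hx hu with ⟨b, hb, he⟩ | ⟨m, c, hm, hcm, he⟩
  · exact Or.inl ⟨b, hb, funext fun t => (he t.2).symm⟩
  · exact Or.inr (mem_biUnion (show m ∈ M from hm) ⟨c, hcm, funext fun t => (he t.2).symm⟩)

/-! ### The distance between antipodal points -/

theorem grusinDist_le_grusinLength {n : ℕ} {p q : GrusinSpace n} {b : ℝ} (hb : b ≠ 0)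
    {c : EuclideanSpace ℝ (Fin n)} (h : grusinCurve p b c 1 = q) :
    grusinDist p q ≤ grusinLength (grusinCurve p b c) :=
  iInf₂_le (grusinCurve p b c) ⟨isHorizontalCurve_grusinCurve p hb c, grusinCurve_zero p b c, h⟩

theorem ofReal_sqrt_le_grusinDist {n : ℕ} {b : ℝ} (hb : b ∈ Ioo 0 Real.pi)
    (x : EuclideanSpace ℝ (Fin n)) (u : ℝ) :
    ENNReal.ofReal (Real.sqrt (2 * b * u + 2 * ‖x‖ ^ 2 * b * Real.cot (b / 2))) ≤
      grusinDist (x, 0) (-x, u) :=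
  le_iInf₂ fun _ hγ => ofReal_sqrt_le_grusinLength hb hγ.1 hγ.2.1 hγ.2.2

theorem grusinDist_eq_grusinLength_antipodalCurve {n : ℕ} {x : EuclideanSpace ℝ (Fin n)}
    {u b : ℝ} (hx : x ≠ 0) (hu : 0 < u) (hb : b ∈ Ioo 0 Real.pi) (h : IsMuTildeSolution x u b) :
    grusinDist (x, 0) (-x, u) = grusinLength (antipodalCurve x b) := by
  refine le_antisymm (grusinDist_le_grusinLength hb.1.ne'
    (isGrusinGeodesicFromTo_antipodalCurve hx hu h).2.2) ?_
  rw [grusinLength_antipodalCurve x hb.1.ne' (h.sin_ne_zero hx hu),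
    sq_div_sin_sq_mul_norm_sq hx h]
  exact ofReal_sqrt_le_grusinDist hb x u

/-- The limit `b → π` of the lower bounds `ofReal_sqrt_le_grusinDist`. -/
theorem ofReal_sqrt_two_pi_le_grusinDist {n : ℕ} (x : EuclideanSpace ℝ (Fin n)) (u : ℝ) :
    ENNReal.ofReal (Real.sqrt (2 * Real.pi * u)) ≤ grusinDist (x, 0) (-x, u) := by
  have hcot : ContinuousAt (fun b => Real.cot (b / 2)) Real.pi := by
    refine ContinuousAt.comp' (g := Real.cot) (hasDerivAt_cot ?_).continuousAt (by fun_prop)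
    simp
  have hcont : ContinuousAt (fun b => ENNReal.ofReal (Real.sqrt
      (2 * b * u + 2 * ‖x‖ ^ 2 * b * Real.cot (b / 2)))) Real.pi := by
    refine ENNReal.continuous_ofReal.continuousAt.comp' (Real.continuous_sqrt.continuousAt.comp' ?_)
    exact ContinuousAt.add (by fun_prop) (ContinuousAt.mul (by fun_prop) hcot)
  have hlim := hcont.tendsto.mono_left (nhdsWithin_le_nhds (s := Iio Real.pi))
  rw [show 2 * Real.pi * u + 2 * ‖x‖ ^ 2 * Real.pi * Real.cot (Real.pi / 2) = 2 * Real.pi * u by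
    simp [Real.cot_eq_cos_div_sin]] at hlim
  refine le_of_tendsto hlim ?_
  filter_upwards [Ioo_mem_nhdsLT Real.pi_pos] with b hb
  exact ofReal_sqrt_le_grusinDist hb x u

theorem existsUnique_isMuTildeSolution {n : ℕ} {x : EuclideanSpace ℝ (Fin n)} {u : ℝ}
    (hx : x ≠ 0) (hu : 0 < u) (h : 2 * u < Real.pi * ‖x‖ ^ 2) :
    ∃! b : ℝ, b ∈ Ioo 0 Real.pi ∧ IsMuTildeSolution x u b := by
  have hX : 0 < ‖x‖ ^ 2 := by positivity
  obtain ⟨s, hs, hsK⟩ := exists_muTilde_eq (div_pos hu hX) (by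
    rw [div_lt_iff₀ hX]
    linarith)
  have hmem : ∀ b ∈ Ioo 0 Real.pi, b / 2 ∈ Ioo 0 Real.pi := fun b hb =>
    ⟨by linarith [hb.1], by linarith [hb.1, hb.2]⟩
  refine ⟨2 * s, ⟨⟨by linarith [hs.1], by linarith [hs.2]⟩, ?_⟩, fun b hb => ?_⟩
  · have e : 2 * s / 2 = s := by ring
    refine isMuTildeSolution_of_sin_ne_zero ?_ hx ?_
    · rw [e]
      exact (Real.sin_pos_of_mem_Ioo ⟨hs.1, by linarith [hs.2, Real.pi_pos]⟩).ne'
    · rw [e, hsK, mul_div_cancel₀ _ hX.ne']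
  · have := injOn_muTilde_Ioo (hmem b hb.1) ⟨hs.1, by linarith [hs.2, Real.pi_pos]⟩
      (hb.2.2.symm.trans hsK.symm)
    linarith

theorem grusinLength_antipodalCurve_lt_of_not_eqOn {n : ℕ} {x : EuclideanSpace ℝ (Fin n)}
    {u b : ℝ} (hx : x ≠ 0) (hu : 0 < u) (h : 2 * u < Real.pi * ‖x‖ ^ 2)
    (hb : b ∈ Ioo 0 Real.pi) (hsol : IsMuTildeSolution x u b) {γ : ℝ → GrusinSpace n}
    (hγ : IsGrusinGeodesicFromTo (x, 0) (-x, u) γ)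
    (hne : ¬ EqOn γ (antipodalCurve x b) (Icc 0 1)) :
    grusinLength (antipodalCurve x b) < grusinLength γ := by
  rcases hγ.antipodal_cases hx hu with ⟨b', hb', he⟩ | ⟨m, c, hm, -, -⟩
  · rw [grusinLength_congr he]
    refine grusinLength_antipodalCurve_lt hx hu hsol hb' (lt_of_not_ge fun hle => hne ?_)
    have : b' = b := (existsUnique_isMuTildeSolution hx hu h).unique
      ⟨⟨hb'.pos hx hu, hle.trans_lt hb.2⟩, hb'⟩ ⟨hb, hsol⟩
    exact this ▸ he
  · have hpos : 0 ≤ m * Real.pi * ‖x‖ ^ 2 := by positivity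
    linarith

theorem grusinDist_antipodal_of_pi_mul_le {n : ℕ} {x : EuclideanSpace ℝ (Fin n)} {u : ℝ}
    (hx : x ≠ 0) (h : Real.pi * ‖x‖ ^ 2 ≤ 2 * u) :
    grusinDist (x, 0) (-x, u) = ENNReal.ofReal (Real.sqrt (2 * Real.pi * u)) := by
  refine le_antisymm ?_ (ofReal_sqrt_two_pi_le_grusinDist x u)
  have hm : (2 * (0 : ℕ) + 1) * Real.pi * ‖x‖ ^ 2 ≤ 2 * u := by simpa using h
  obtain ⟨c, hc⟩ := exists_norm_eq_of_ne_zero hx (Real.sqrt_nonneg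
    (2 * (2 * (0 : ℕ) + 1) * Real.pi * u - (2 * (0 : ℕ) + 1) ^ 2 * Real.pi ^ 2 * ‖x‖ ^ 2))
  refine (grusinDist_le_grusinLength (by positivity)
    (isGrusinGeodesicFromTo_grusinCurve_odd hm hc).2.2).trans ?_
  rw [grusinLength_grusinCurve_odd hm hc]
  simp

theorem mainTheorem6 (n : ℕ) (x : EuclideanSpace ℝ (Fin n)) (u : ℝ) (hx : x ≠ 0) (hu : 0 < u) :
    -- first kind: existence and length
    (∀ b : ℝ, IsMuTildeSolution x u b →
      IsGrusinGeodesicFromTo (x, 0) (-x, u) (antipodalCurve x b) ∧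
      grusinLength (antipodalCurve x b) ^ 2
        = ENNReal.ofReal (b ^ 2 / Real.sin (b / 2) ^ 2 * ‖x‖ ^ 2) ∧
      b ^ 2 / Real.sin (b / 2) ^ 2 * ‖x‖ ^ 2
        = 2 * b * u + 2 * ‖x‖ ^ 2 * b * Real.cot (b / 2)) ∧
    -- first kind: the length is strictly increasing in the parameter
    (∀ b b' : ℝ, IsMuTildeSolution x u b → IsMuTildeSolution x u b' → b < b' →
      grusinLength (antipodalCurve x b) < grusinLength (antipodalCurve x b')) ∧
    -- second kind: existence and length
    (∀ m : ℕ, (2 * m + 1) * Real.pi * ‖x‖ ^ 2 ≤ 2 * u →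
      (∃ c : EuclideanSpace ℝ (Fin n), ‖c‖ = Real.sqrt
        (2 * (2 * m + 1) * Real.pi * u - (2 * m + 1) ^ 2 * Real.pi ^ 2 * ‖x‖ ^ 2)) ∧
      ∀ c : EuclideanSpace ℝ (Fin n), ‖c‖ = Real.sqrt
        (2 * (2 * m + 1) * Real.pi * u - (2 * m + 1) ^ 2 * Real.pi ^ 2 * ‖x‖ ^ 2) →
        IsGrusinGeodesicFromTo (x, 0) (-x, u) (grusinCurve (x, 0) ((2 * m + 1) * Real.pi) c) ∧
        grusinLength (grusinCurve (x, 0) ((2 * m + 1) * Real.pi) c)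
          = ENNReal.ofReal (Real.sqrt (2 * (2 * m + 1) * Real.pi * u))) ∧
    -- there are no other geodesics
    (∀ γ : ℝ → GrusinSpace n, IsGrusinGeodesicFromTo (x, 0) (-x, u) γ →
      (∃ b : ℝ, IsMuTildeSolution x u b ∧ Set.EqOn γ (antipodalCurve x b) (Set.Icc 0 1)) ∨
      (∃ (m : ℕ) (c : EuclideanSpace ℝ (Fin n)),
        (2 * m + 1) * Real.pi * ‖x‖ ^ 2 ≤ 2 * u ∧
        ‖c‖ = Real.sqrt
          (2 * (2 * m + 1) * Real.pi * u - (2 * m + 1) ^ 2 * Real.pi ^ 2 * ‖x‖ ^ 2) ∧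
        Set.EqOn γ (grusinCurve (x, 0) ((2 * m + 1) * Real.pi) c) (Set.Icc 0 1))) ∧
    -- finiteness: of the parameters in general, of the geodesics where the spheres of
    -- admissible `c` are finite
    {b : ℝ | IsMuTildeSolution x u b}.Finite ∧
    {m : ℕ | (2 * m + 1) * Real.pi * ‖x‖ ^ 2 ≤ 2 * u}.Finite ∧
    (n = 1 ∨ 2 * u ≤ Real.pi * ‖x‖ ^ 2 →
      ((fun γ : ℝ → GrusinSpace n => (Set.Icc (0 : ℝ) 1).domRestrict γ) ''
        {γ | IsGrusinGeodesicFromTo (x, 0) (-x, u) γ}).Finite) ∧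
    -- shortest geodesic and distance, first case
    (2 * u < Real.pi * ‖x‖ ^ 2 →
      (∃! b : ℝ, b ∈ Set.Ioo 0 Real.pi ∧ IsMuTildeSolution x u b) ∧
      ∀ b : ℝ, b ∈ Set.Ioo 0 Real.pi → IsMuTildeSolution x u b →
        (∀ γ : ℝ → GrusinSpace n, IsGrusinGeodesicFromTo (x, 0) (-x, u) γ →
          ¬ Set.EqOn γ (antipodalCurve x b) (Set.Icc 0 1) →
          grusinLength (antipodalCurve x b) < grusinLength γ) ∧
        grusinDist (x, 0) (-x, u) = grusinLength (antipodalCurve x b) ∧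
        grusinDist (x, 0) (-x, u) = ENNReal.ofReal (b / Real.sin (b / 2) * ‖x‖) ∧
        grusinDist (x, 0) (-x, u) = ENNReal.ofReal
          (Real.sqrt (2 * b * u + 2 * ‖x‖ ^ 2 * b * Real.cot (b / 2)))) ∧
    -- distance, second case
    (Real.pi * ‖x‖ ^ 2 ≤ 2 * u →
      grusinDist (x, 0) (-x, u) = ENNReal.ofReal (Real.sqrt (2 * Real.pi * u))) := by
  refine ⟨fun b hb => ⟨isGrusinGeodesicFromTo_antipodalCurve hx hu hb, ?_,
      sq_div_sin_sq_mul_norm_sq hx hb⟩,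
    fun b b' hb hb' hlt => grusinLength_antipodalCurve_lt hx hu hb hb' hlt,
    fun m hm => ⟨exists_norm_eq_of_ne_zero hx (Real.sqrt_nonneg _), fun c hc =>
      ⟨isGrusinGeodesicFromTo_grusinCurve_odd hm hc, grusinLength_grusinCurve_odd hm hc⟩⟩,
    fun γ hγ => hγ.antipodal_cases hx hu,
    finite_isMuTildeSolution hx hu, finite_odd_mul_pi_le (by positivity),
    finite_geodesics_antipodal hx hu,
    fun h => ⟨existsUnique_isMuTildeSolution hx hu h, fun b hb hsol => ?_⟩,
    grusinDist_antipodal_of_pi_mul_le hx⟩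
  · rw [grusinLength_antipodalCurve x (hb.pos hx hu).ne' (hb.sin_ne_zero hx hu),
      ← ENNReal.ofReal_pow (Real.sqrt_nonneg _), Real.sq_sqrt (by positivity)]
  · have hdist := grusinDist_eq_grusinLength_antipodalCurve hx hu hb hsol
    have hlen := grusinLength_antipodalCurve x hb.1.ne' (hsol.sin_ne_zero hx hu)
    have hsin : 0 < Real.sin (b / 2) :=
      Real.sin_pos_of_mem_Ioo ⟨by linarith [hb.1], by linarith [hb.1, hb.2]⟩
    refine ⟨fun γ hγ hne => grusinLength_antipodalCurve_lt_of_not_eqOn hx hu h hb hsol hγ hne,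
      hdist, ?_, ?_⟩
    · rw [hdist, hlen, ← div_pow, ← mul_pow,
        Real.sqrt_sq (mul_nonneg (div_nonneg hb.1.le hsin.le) (norm_nonneg x))]
    · rw [hdist, hlen, sq_div_sin_sq_mul_norm_sq hx hsol]
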